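/- Let $n\ge 2$, let $G=([n],E)$ be a connected graph with maximum and minimum degrees $d_{\max},d_{\min}$, and put $\kappa=d_{\max}/d_{\min}$. Let $\gamma=1-\lambda_2$ be the spectral gap of the transition matrix $D^{-1}B$ of the unbiased random walk on $G$, where $B$ is the adjacency matrix, $D$ the diagonal matrix of degrees, and $\lambda_2$ the second largest eigenvalue (with multiplicity) of $D^{-1}B$. Let $w^*\in\mathbf R_{>0}^n$ be the weights of a Bradley--Terry model, let $b=\max_{i,j}w^*_i/w^*_j$, and let the weights be scaled so that $w^*_i\in[1/b,1]$ for all $i$. Every pair $\{i,j\}\in E$ is compared exactly $k$ times; all comparisons are independent, and in each comparison of $i$ and $j$ item $i$ is preferred with probability $w^*_i/(w^*_i+w^*_j)$. For $\{i,j\}\in E$ let $a_{ij}$ be the fraction of the $k$ comparisons of $i$ and $j$ in which $j$ was preferred, let $a_{ij}=0$ for $\{i,j\}\notin E$, and let $\bar P_{ij}=a_{ij}/d_{\max}$ for $i\ne j$ and $\bar P_{ii}=1-\frac1{d_{\max}}\sum_{l\ne i}a_{il}$. The Rank Centrality estimate $\bar\pi$ is the unique stationary probability distribution of $\bar P$ (if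 there is exactly one), and in the weight parameterization it is $\bar w=\bigl(\sum_j w^*_j\bigr)\bar\pi$, the multiple of $\bar\pi$ that has the same sum as $w^*$. There are constants $C,c,\alpha>0$ (not depending on $n$, $k$, $G$ or $w^*$) such that in every such setting with $$k\ \ge\ 4C^2\Bigl(1+\frac{b^5\kappa^2}{d_{\max}\gamma^2}\log n\Bigr),$$ with probability at least $1-c/n^{\alpha}$ the matrix $\bar P$ has exactly one stationary probability distribution $\bar\pi$ and $$\lVert\bar w-w^*\rVert_2\ <\ C\,\frac{b^3\kappa}{\gamma}\sqrt{\frac{n\log n}{k\,d_{\max}}}.$$ -/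

import Mathlib

open MeasureTheory ProbabilityTheory

noncomputable section

namespace RankCentrality

/-- The compared pairs: edges of the comparison graph, each listed once as `(i, j)` with `i < j`. -/
abbrev Pair {n : ℕ} (G : SimpleGraph (Fin n)) : Type :=
  {p : Fin n × Fin n // p.1 < p.2 ∧ G.Adj p.1 p.2}

/-- The outcomes of `k` comparisons of every compared pair. For a pair `(i, j)` with `i < j`,
the value `true` in a round means that `i` is preferred to `j`, the value `false` that `j` is
preferred to `i`. -/
abbrev Outcomes {n : ℕ} (G : SimpleGraph (Fin n)) (k : ℕ) : Type :=
  Pair G × Fin k → Bool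

/-- The random outcomes `Y` follow the Bradley--Terry model with weights `w`: all comparisons are
independent, and in each comparison of `(i, j)` item `i` is preferred with probability
`w i / (w i + w j)`. -/
structure IsBradleyTerry {n k : ℕ} (G : SimpleGraph (Fin n)) (w : Fin n → ℝ)
    {Ω : Type*} [MeasurableSpace Ω] (P : Measure Ω) (Y : Pair G × Fin k → Ω → Bool) : Prop where
  measurable : ∀ q, Measurable (Y q)
  indep : iIndepFun Y P
  law : ∀ (p : Pair G) (m : Fin k),
    P.real {ω | Y (p, m) ω = true} = w p.1.1 / (w p.1.1 + w p.1.2)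

section Estimate

variable {n k : ℕ} (G : SimpleGraph (Fin n)) [DecidableRel G.Adj]

/-- The number of times `i` was preferred to `j` (zero if the two were not compared). -/
def wins (y : Outcomes G k) (i j : Fin n) : ℕ :=
  if h : i < j ∧ G.Adj i j then
    (Finset.univ.filter fun m : Fin k => y (⟨(i, j), h⟩, m) = true).card
  else if h : j < i ∧ G.Adj j i then
    (Finset.univ.filter fun m : Fin k => y (⟨(j, i), h⟩, m) = false).card
  else 0

/-- `a i j`: the ratio of wins of `j` over `i` (zero if the two were not compared). -/
def ratio (y : Outcomes G k) (i j : Fin n) : ℝ :=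
  (wins G y j i : ℝ) / k

/-- The Rank Centrality transition matrix, with `ε = 1 / d_max`. -/
def transition (y : Outcomes G k) : Matrix (Fin n) (Fin n) ℝ :=
  Matrix.of fun i j =>
    if i = j then
      1 - 1 / (G.maxDegree : ℝ) * ∑ l ∈ Finset.univ.erase i, ratio G y i l
    else 1 / (G.maxDegree : ℝ) * ratio G y i j

/-- `π` is a stationary probability distribution of the transition matrix `T`. -/
def IsStationary (T : Matrix (Fin n) (Fin n) ℝ) (π : Fin n → ℝ) : Prop :=
  π ∈ stdSimplex ℝ (Fin n) ∧ Matrix.vecMul π T = π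

/-- `π` is the Rank Centrality estimate for the outcomes `y`: the unique stationary distribution
of the Rank Centrality chain. -/
def IsEstimate (y : Outcomes G k) (π : Fin n → ℝ) : Prop :=
  IsStationary (transition G y) π ∧ ∀ π', IsStationary (transition G y) π' → π' = π

/-- The transition matrix `D⁻¹ B` of the unbiased random walk on `G`. -/
def walkMatrix : Matrix (Fin n) (Fin n) ℝ :=
  (Matrix.diagonal fun i => (G.degree i : ℝ))⁻¹ * G.adjMatrix ℝ

/-- The spectral gap `1 - λ₂` of the random walk on `G`. As the constant vectors are eigenvectors
for the largest eigenvalue `λ₁ = 1`, the second largest eigenvalue counted with multiplicity is the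
largest one that has a nonconstant eigenvector. -/
def spectralGap : ℝ :=
  1 - sSup {μ : ℝ | ∃ f : Fin n → ℝ, (∃ i j, f i ≠ f j) ∧ (walkMatrix G).mulVec f = μ • f}

/-- The degree ratio `κ = d_max / d_min`. -/
def degreeRatio : ℝ := (G.maxDegree : ℝ) / (G.minDegree : ℝ)

end Estimate

/-- The dynamic range `b = max_{i,j} w i / w j`. -/
def dynamicRange {n : ℕ} (w : Fin n → ℝ) : ℝ := ⨆ q : Fin n × Fin n, w q.1 / w q.2

/-- The weight vector with the same sum as `w` that is proportional to the distribution `π`. -/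
def weights {n : ℕ} (w π : Fin n → ℝ) : Fin n → ℝ := fun i => (∑ j, w j) * π i

end RankCentrality

end

noncomputable section

namespace RankCentrality

/-! ### Trace inequalities for symmetric matrices. -/

section Moments

open Matrix

/-! The proof is an energy estimate for the balance equations combined with a matrix concentration
bound.

Deterministic part. Stationarity says that the net flow of `x` into every vertex vanishes. The
Bradley--Terry chain is reversible with respect to `w`, so if `x = w (f + s)` the equations say that
`f` is a potential on a network with conductances `w i * w j / (w i + w j)`, driven by the
deviations of the observed ratios. Testing with `f` gives `energy_eq`: the Dirichlet energy of `f`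
is twice the deviation form at `(x, f)`. The Poincaré inequality `spectralGap_mul_le` bounds the
energy below by the spectral gap. If the deviation form has norm at most a small `K`, the part of it
that is quadratic in the error is absorbed, and the error is at most of order `K * s`
(`sqrt_sum_sq_sub_le`). The case `s = 1` is accuracy; the case `s = 0`, applied to the difference of
two stationary distributions, is uniqueness.

Random part. The dilation of the deviation form, times `k`, is a sum of independent centred
multiples of fixed symmetric matrices, one for each comparison. Its even trace moments are bounded
by resampling one coordinate at a time, the method of exchangeable pairs (`sum_trace_pow_le`).
Markov's inequality with a moment of order about `2 log n` makes its norm at most of order `√(k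
d_max log n)` with high probability (`IsBradleyTerry.one_sub_le`). -/

theorem exists_orthogonal_diagonalization {ι : Type*} [Fintype ι] [DecidableEq ι]
    {A : Matrix ι ι ℝ} (hA : A.IsSymm) :
    ∃ (U : Matrix ι ι ℝ) (d : ι → ℝ), U * Uᵀ = 1 ∧ Uᵀ * U = 1 ∧
      A = U * diagonal d * Uᵀ := by
  have hH : A.IsHermitian := by
    rw [Matrix.IsHermitian, conjTranspose_eq_transpose_of_trivial, hA.eq]
  refine ⟨hH.eigenvectorUnitary, hH.eigenvalues, ?_, ?_, ?_⟩
  · have := Unitary.coe_mul_star_self hH.eigenvectorUnitary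
    simpa [star_eq_conjTranspose, conjTranspose_eq_transpose_of_trivial] using this
  · have := Unitary.coe_star_mul_self hH.eigenvectorUnitary
    simpa [star_eq_conjTranspose, conjTranspose_eq_transpose_of_trivial] using this
  · have := hH.spectral_theorem
    simpa [Unitary.conjStarAlgAut_apply, star_eq_conjTranspose,
      conjTranspose_eq_transpose_of_trivial, Function.comp_def] using this

variable {ι : Type*} [Fintype ι] [DecidableEq ι]

theorem conj_diagonal_pow {U : Matrix ι ι ℝ} (d : ι → ℝ) (h1 : U * Uᵀ = 1) (h2 : Uᵀ * U = 1)
    (m : ℕ) : (U * diagonal d * Uᵀ) ^ m = U * diagonal (fun i => d i ^ m) * Uᵀ := by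
  induction m with
  | zero => simp [h1]
  | succ m ih =>
    rw [pow_succ, ih]
    calc U * diagonal (fun i => d i ^ m) * Uᵀ * (U * diagonal d * Uᵀ)
        = U * diagonal (fun i => d i ^ m) * (Uᵀ * U) * diagonal d * Uᵀ := by
          simp only [Matrix.mul_assoc]
      _ = _ := by
          rw [h2, Matrix.mul_one, Matrix.mul_assoc U, diagonal_mul_diagonal]
          simp [pow_succ]

theorem trace_diagonal_conj (a c : ι → ℝ) (G : Matrix ι ι ℝ) :
    trace (diagonal a * G * diagonal c * Gᵀ) = ∑ i, ∑ k, a i * c k * G i k ^ 2 := by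
  simp only [trace, diag_apply, Matrix.mul_apply (M := diagonal a * G * diagonal c),
    mul_diagonal, diagonal_mul, transpose_apply]
  refine Finset.sum_congr rfl fun i _ => Finset.sum_congr rfl fun k _ => by ring

theorem abs_pow_mul_pow_le (x y : ℝ) {j l : ℕ} (h : Even (j + l)) :
    |x ^ j * y ^ l| ≤ x ^ (j + l) + y ^ (j + l) := by
  rw [abs_mul, abs_pow, abs_pow]
  rw [← h.pow_abs x, ← h.pow_abs y]
  have hx := abs_nonneg x
  have hy := abs_nonneg y
  rcases le_total |x| |y| with hxy | hxy
  · have : |x| ^ j * |y| ^ l ≤ |y| ^ j * |y| ^ l := by gcongr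
    rw [← pow_add] at this
    have := pow_nonneg hx (j + l)
    linarith
  · have : |x| ^ j * |y| ^ l ≤ |x| ^ j * |x| ^ l := by gcongr
    rw [← pow_add] at this
    have := pow_nonneg hy (j + l)
    linarith

/-- In eigenbases of `W` and `Y` all three traces become sums of products of eigenvalue powers
against the same nonnegative weights, the squared entries of `Uᵀ * H * V`. So the noncommutative
inequality reduces to the scalar one, `abs_pow_mul_pow_le`. -/
theorem abs_trace_le {H W Y : Matrix ι ι ℝ} (hH : H.IsSymm) (hW : W.IsSymm) (hY : Y.IsSymm)
    {j l : ℕ} (h : Even (j + l)) :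
    |trace (H * W ^ j * H * Y ^ l)| ≤
      trace (H * H * W ^ (j + l)) + trace (H * H * Y ^ (j + l)) := by
  obtain ⟨U, a, hU1, hU2, rfl⟩ := exists_orthogonal_diagonalization hW
  obtain ⟨V, c, hV1, hV2, rfl⟩ := exists_orthogonal_diagonalization hY
  have key : ∀ s r : ℕ, trace (H * (U * diagonal a * Uᵀ) ^ s * H * (V * diagonal c * Vᵀ) ^ r) =
      ∑ i, ∑ k, a i ^ s * c k ^ r * (Uᵀ * H * V) i k ^ 2 := by
    intro s r
    rw [conj_diagonal_pow a hU1 hU2, conj_diagonal_pow c hV1 hV2, ← trace_diagonal_conj,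
      transpose_mul, transpose_mul, transpose_transpose, hH.eq]
    calc _ = trace (H * U * (diagonal (fun i => a i ^ s) * (Uᵀ * H * V) *
          diagonal (fun k => c k ^ r) * Vᵀ)) := by simp only [Matrix.mul_assoc]
      _ = _ := by rw [trace_mul_comm]; simp only [Matrix.mul_assoc]
  have e1 : trace (H * H * (U * diagonal a * Uᵀ) ^ (j + l)) =
      ∑ i, ∑ k, a i ^ (j + l) * c k ^ 0 * (Uᵀ * H * V) i k ^ 2 := by
    rw [← key, pow_zero, Matrix.mul_one, trace_mul_comm _ H, Matrix.mul_assoc]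
  have e2 : trace (H * H * (V * diagonal c * Vᵀ) ^ (j + l)) =
      ∑ i, ∑ k, a i ^ 0 * c k ^ (j + l) * (Uᵀ * H * V) i k ^ 2 := by
    rw [← key, pow_zero, Matrix.mul_one]
  rw [key, e1, e2, ← Finset.sum_add_distrib]
  refine (Finset.abs_sum_le_sum_abs _ _).trans (Finset.sum_le_sum fun i _ => ?_)
  rw [← Finset.sum_add_distrib]
  refine (Finset.abs_sum_le_sum_abs _ _).trans (Finset.sum_le_sum fun k _ => ?_)
  rw [abs_mul, abs_of_nonneg (sq_nonneg ((Uᵀ * H * V) i k))]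
  have := mul_le_mul_of_nonneg_right (abs_pow_mul_pow_le (a i) (c k) h)
    (sq_nonneg ((Uᵀ * H * V) i k))
  linarith

/-- In an eigenbasis of `W` the trace is a sum of values of the quadratic form of `A` weighted by
even powers of eigenvalues, which are nonnegative. -/
theorem trace_mul_pow_le {A W : Matrix ι ι ℝ} (hW : W.IsSymm) {V : ℝ}
    (hA : ∀ v : ι → ℝ, v ⬝ᵥ A *ᵥ v ≤ V * (v ⬝ᵥ v)) {m : ℕ} (hm : Even m) :
    trace (A * W ^ m) ≤ V * trace (W ^ m) := by
  obtain ⟨U, a, hU1, hU2, rfl⟩ := exists_orthogonal_diagonalization hW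
  rw [conj_diagonal_pow a hU1 hU2]
  have e : ∀ B : Matrix ι ι ℝ, trace (B * (U * diagonal (fun i => a i ^ m) * Uᵀ)) =
      ∑ i, (Uᵀ i ⬝ᵥ B *ᵥ Uᵀ i) * a i ^ m := by
    intro B
    rw [← Matrix.mul_assoc, trace_mul_comm, ← Matrix.mul_assoc, ← Matrix.mul_assoc]
    simp only [trace, diag_apply, mul_diagonal]
    refine Finset.sum_congr rfl fun i _ => ?_
    congr 1
    rw [Matrix.mul_assoc]
    rfl
  have e1 := e 1
  rw [Matrix.one_mul] at e1
  rw [e, e1, Finset.mul_sum]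
  refine Finset.sum_le_sum fun i _ => ?_
  have h := mul_le_mul_of_nonneg_right (hA (Uᵀ i)) (hm.pow_nonneg (a i))
  rw [one_mulVec]
  linarith

theorem trace_pow_nonneg {W : Matrix ι ι ℝ} (hW : W.IsSymm) {m : ℕ} (hm : Even m) :
    0 ≤ trace (W ^ m) := by
  have := trace_mul_pow_le (A := -1) hW (V := 0) (fun v => by
    rw [neg_mulVec, one_mulVec, dotProduct_neg, zero_mul, neg_nonpos]
    exact Finset.sum_nonneg fun i _ => mul_self_nonneg _) hm
  rw [zero_mul, Matrix.neg_mul, trace_neg, Matrix.one_mul] at this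
  linarith

/-- A symmetric matrix whose even moment is small is small in operator norm. -/
theorem dotProduct_mulVec_self_le {X : Matrix ι ι ℝ} (hX : X.IsSymm) {t : ℝ} {p : ℕ}
    (hp : p ≠ 0) (h : trace (X ^ (2 * p)) ≤ t ^ (2 * p)) (v : ι → ℝ) :
    X *ᵥ v ⬝ᵥ X *ᵥ v ≤ t ^ 2 * (v ⬝ᵥ v) := by
  obtain ⟨U, a, hU1, hU2, rfl⟩ := exists_orthogonal_diagonalization hX
  have ha : ∀ i, a i ^ 2 ≤ t ^ 2 := by
    intro i
    rw [conj_diagonal_pow a hU1 hU2, trace_mul_comm, ← Matrix.mul_assoc, hU2, Matrix.one_mul,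
      trace_diagonal] at h
    have h1 : a i ^ (2 * p) ≤ t ^ (2 * p) := by
      refine le_trans (Finset.single_le_sum (f := fun i => a i ^ (2 * p)) (fun j _ => ?_)
        (Finset.mem_univ i)) h
      exact (even_two_mul p).pow_nonneg _
    rw [pow_mul, pow_mul] at h1
    exact le_of_pow_le_pow_left₀ hp (sq_nonneg _) h1
  have iso : ∀ {O : Matrix ι ι ℝ}, Oᵀ * O = 1 → ∀ x : ι → ℝ, O *ᵥ x ⬝ᵥ O *ᵥ x = x ⬝ᵥ x := by
    intro O hO x
    rw [dotProduct_mulVec, vecMul_mulVec, hO, vecMul_one]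
  rw [← mulVec_mulVec, ← mulVec_mulVec, iso hU2, ← iso (O := Uᵀ) (by simpa using hU1) v]
  simp only [dotProduct, mulVec_diagonal, Finset.mul_sum]
  refine Finset.sum_le_sum fun i _ => ?_
  have := mul_le_mul_of_nonneg_right (ha i) (mul_self_nonneg ((Uᵀ *ᵥ v) i))
  linarith

theorem pow_succ_sub_pow_succ {R : Type*} [Ring R] (x y : R) (m : ℕ) :
    x ^ (m + 1) - y ^ (m + 1) =
      ∑ j ∈ Finset.range (m + 1), x ^ j * (x - y) * y ^ (m - j) := by
  induction m with
  | zero => simp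
  | succ m ih =>
    rw [Finset.sum_range_succ]
    have : ∑ j ∈ Finset.range (m + 1), x ^ j * (x - y) * y ^ (m + 1 - j) =
        (x ^ (m + 1) - y ^ (m + 1)) * y := by
      rw [ih, Finset.sum_mul]
      refine Finset.sum_congr rfl fun j hj => ?_
      have : m + 1 - j = (m - j) + 1 := by
        have := Finset.mem_range.mp hj
        omega
      rw [this, pow_succ, mul_assoc (x ^ j * (x - y))]
    rw [this, Nat.sub_self, pow_zero, mul_one, pow_succ x (m + 1), pow_succ y (m + 1)]
    noncomm_ring

omit [Fintype ι] [DecidableEq ι] in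
theorem isSymm_sum_smul {Q : Type*} [Fintype Q] (c : Q → ℝ) {H : Q → Matrix ι ι ℝ}
    (hH : ∀ q, (H q).IsSymm) : (∑ q, c q • H q).IsSymm := by
  rw [Matrix.IsSymm, transpose_sum]
  exact Finset.sum_congr rfl fun q _ => by rw [transpose_smul, (hH q).eq]

/-! ### Trace moments by exchangeable pairs. -/

section Exchange

variable {Q S : Type*} [Fintype Q] [DecidableEq Q] [Fintype S] (μ : Q → S → ℝ)

/-- The weight of a configuration under the product of the weights `μ q`. -/
def prodWeight (y : Q → S) : ℝ := ∏ q, μ q (y q)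

omit [Fintype S] in
theorem prodWeight_update_mul (y : Q → S) (q : Q) (b : S) :
    prodWeight μ (Function.update y q b) * μ q (y q) = prodWeight μ y * μ q b := by
  unfold prodWeight
  rw [← Finset.mul_prod_erase _ _ (Finset.mem_univ q),
    ← Finset.mul_prod_erase (a := q) _ (fun q => μ q (y q)) (Finset.mem_univ q)]
  have : ∏ x ∈ Finset.univ.erase q, μ x (Function.update y q b x) =
      ∏ x ∈ Finset.univ.erase q, μ x (y x) :=
    Finset.prod_congr rfl fun x hx => by
      rw [Function.update_of_ne (Finset.ne_of_mem_erase hx)]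
  rw [this, Function.update_self]
  ring

omit [DecidableEq Q] [Fintype S] in
theorem prodWeight_nonneg (hμ : ∀ q s, 0 ≤ μ q s) (y : Q → S) : 0 ≤ prodWeight μ y :=
  Finset.prod_nonneg fun q _ => hμ q _

theorem sum_prodWeight (h1 : ∀ q, ∑ s, μ q s = 1) : ∑ y, prodWeight μ y = 1 := by
  unfold prodWeight
  rw [← Fintype.prod_sum]
  simp [h1]

/-- Resampling one coordinate gives an exchangeable pair of configurations. -/
theorem sum_exchange (q : Q) (F : (Q → S) → (Q → S) → ℝ) :
    ∑ y, ∑ b, prodWeight μ y * μ q b * F y (Function.update y q b) =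
      ∑ y, ∑ b, prodWeight μ y * μ q b * F (Function.update y q b) y := by
  rw [← Fintype.sum_prod_type', ← Fintype.sum_prod_type']
  -- Swapping the old and the new value of the coordinate is a weight-preserving involution.
  have hinv : Function.Involutive
      fun z : (Q → S) × S => (Function.update z.1 q z.2, z.1 q) := by
    rintro ⟨y, b⟩
    simp
  refine Fintype.sum_equiv hinv.toPerm _ _ ?_
  rintro ⟨y, b⟩
  simp only [Function.Involutive.coe_toPerm, prodWeight_update_mul, Function.update_idem,
    Function.update_eq_self]

variable (X : (Q → S) → Matrix ι ι ℝ) (H : Q → Matrix ι ι ℝ) (ζ : Q → S → ℝ)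

/-- A discrete integration by parts. After resampling coordinate `q` the new matrix is independent
of the old centred factor, so its power may be subtracted for free. The difference of powers
telescopes into `2 * r + 1` terms, each with a second factor `H q`; `abs_trace_le` separates old and
new matrix, and exchangeability identifies the two resulting averages, whence the factor 2. -/
theorem sum_mul_trace_pow_succ_le {μ} (hμ : ∀ q s, 0 ≤ μ q s) (h1 : ∀ q, ∑ s, μ q s = 1)
    (h0 : ∀ q, ∑ s, μ q s * ζ q s = 0) (hζ : ∀ q s, |ζ q s| ≤ 1)
    (hζ' : ∀ q s s', |ζ q s - ζ q s'| ≤ 1) (hH : ∀ q, (H q).IsSymm)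
    (hX : ∀ y, X y = ∑ q, ζ q (y q) • H q) (q : Q) (r : ℕ) :
    ∑ y, prodWeight μ y * (ζ q (y q) * trace (H q * X y ^ (2 * r + 1))) ≤
      2 * (2 * r + 1) * ∑ y, prodWeight μ y * trace (H q * H q * X y ^ (2 * r)) := by
  have hXs : ∀ y, (X y).IsSymm := fun y => hX y ▸ isSymm_sum_smul (fun q => ζ q (y q)) hH
  have hdiff : ∀ y b, X y - X (Function.update y q b) = (ζ q (y q) - ζ q b) • H q := by
    intro y b
    rw [hX, hX, ← Finset.sum_sub_distrib, Finset.sum_eq_single q]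
    · rw [Function.update_self, sub_smul]
    · intro q' _ hq'
      rw [Function.update_of_ne hq', sub_self]
    · simp
  have hzero : ∑ y, ∑ b, prodWeight μ y * μ q b *
      (ζ q (y q) * trace (H q * X (Function.update y q b) ^ (2 * r + 1))) = 0 := by
    rw [sum_exchange μ q fun y y' => ζ q (y q) * trace (H q * X y' ^ (2 * r + 1))]
    refine Finset.sum_eq_zero fun y _ => ?_
    calc _ = prodWeight μ y * trace (H q * X y ^ (2 * r + 1)) * ∑ b, μ q b * ζ q b := by
          rw [Finset.mul_sum]
          refine Finset.sum_congr rfl fun b _ => ?_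
          rw [Function.update_self]
          ring
      _ = 0 := by rw [h0, mul_zero]
  have hexp : ∀ f : (Q → S) → ℝ, ∑ y, prodWeight μ y * f y =
      ∑ y, ∑ b, prodWeight μ y * μ q b * f y := by
    intro f
    refine Finset.sum_congr rfl fun y _ => ?_
    rw [← Finset.sum_mul, ← Finset.mul_sum, h1, mul_one]
  have hterm : ∀ y b, ζ q (y q) * trace (H q * X y ^ (2 * r + 1)) -
      ζ q (y q) * trace (H q * X (Function.update y q b) ^ (2 * r + 1)) ≤
      (2 * r + 1) * (trace (H q * H q * X y ^ (2 * r)) +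
        trace (H q * H q * X (Function.update y q b) ^ (2 * r))) := by
    intro y b
    set X' := X (Function.update y q b)
    have e : trace (H q * X y ^ (2 * r + 1)) - trace (H q * X' ^ (2 * r + 1)) =
        ∑ j ∈ Finset.range (2 * r + 1),
          (ζ q (y q) - ζ q b) * trace (H q * X y ^ j * H q * X' ^ (2 * r - j)) := by
      rw [← trace_sub, ← Matrix.mul_sub, pow_succ_sub_pow_succ, hdiff, Finset.mul_sum, trace_sum]
      refine Finset.sum_congr rfl fun j _ => ?_
      rw [Matrix.mul_smul, Matrix.smul_mul, Matrix.mul_smul, trace_smul, smul_eq_mul]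
      simp only [Matrix.mul_assoc]
    rw [← mul_sub, e, Finset.mul_sum]
    have hj : ∀ j ∈ Finset.range (2 * r + 1),
        ζ q (y q) * ((ζ q (y q) - ζ q b) * trace (H q * X y ^ j * H q * X' ^ (2 * r - j))) ≤
        trace (H q * H q * X y ^ (2 * r)) + trace (H q * H q * X' ^ (2 * r)) := by
      intro j hj
      have hj' : j + (2 * r - j) = 2 * r := by
        have := Finset.mem_range.mp hj
        omega
      have h := abs_trace_le (hH q) (hXs y) (hXs (Function.update y q b)) (j := j)
        (l := 2 * r - j) (by rw [hj']; exact even_two_mul r)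
      rw [hj'] at h
      refine le_trans (le_abs_self _) (le_trans ?_ h)
      rw [← mul_assoc, abs_mul, abs_mul]
      have := mul_le_one₀ (hζ q (y q)) (abs_nonneg _) (hζ' q (y q) b)
      exact mul_le_of_le_one_left (abs_nonneg _) this
    refine (Finset.sum_le_sum hj).trans (le_of_eq ?_)
    rw [Finset.sum_const, Finset.card_range, nsmul_eq_mul]
    push_cast
    ring
  have hsym := sum_exchange μ q fun y _ => trace (H q * H q * X y ^ (2 * r))
  calc ∑ y, prodWeight μ y * (ζ q (y q) * trace (H q * X y ^ (2 * r + 1)))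
      = ∑ y, ∑ b, prodWeight μ y * μ q b * (ζ q (y q) * trace (H q * X y ^ (2 * r + 1)) -
          ζ q (y q) * trace (H q * X (Function.update y q b) ^ (2 * r + 1))) := by
        simp only [mul_sub, Finset.sum_sub_distrib] at hzero ⊢
        rw [hzero, sub_zero, hexp]
    _ ≤ ∑ y, ∑ b, prodWeight μ y * μ q b * ((2 * r + 1) *
          (trace (H q * H q * X y ^ (2 * r)) +
            trace (H q * H q * X (Function.update y q b) ^ (2 * r)))) :=
        Finset.sum_le_sum fun y _ => Finset.sum_le_sum fun b _ =>
          mul_le_mul_of_nonneg_left (hterm y b)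
            (mul_nonneg (prodWeight_nonneg μ hμ y) (hμ q b))
    _ = (2 * r + 1) * (∑ y, ∑ b, prodWeight μ y * μ q b * trace (H q * H q * X y ^ (2 * r)) +
          ∑ y, ∑ b, prodWeight μ y * μ q b *
            trace (H q * H q * X (Function.update y q b) ^ (2 * r))) := by
        simp only [← Finset.sum_add_distrib, Finset.mul_sum]
        refine Finset.sum_congr rfl fun y _ => Finset.sum_congr rfl fun b _ => by ring
    _ = _ := by
        rw [← hsym, ← hexp]
        ring

/-- Each step expands one factor of the power, trades it for `∑ q, H q * H q` by the previous lemma,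
and bounds that matrix by `V`. -/
theorem sum_trace_pow_le {μ} (hμ : ∀ q s, 0 ≤ μ q s) (h1 : ∀ q, ∑ s, μ q s = 1)
    (h0 : ∀ q, ∑ s, μ q s * ζ q s = 0) (hζ : ∀ q s, |ζ q s| ≤ 1)
    (hζ' : ∀ q s s', |ζ q s - ζ q s'| ≤ 1) (hH : ∀ q, (H q).IsSymm)
    (hX : ∀ y, X y = ∑ q, ζ q (y q) • H q) {V : ℝ} (hV0 : 0 ≤ V)
    (hV : ∀ v, ∑ q, H q *ᵥ v ⬝ᵥ H q *ᵥ v ≤ V * (v ⬝ᵥ v)) {p r : ℕ} (hr : r ≤ p) :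
    ∑ y, prodWeight μ y * trace (X y ^ (2 * r)) ≤ Fintype.card ι * (4 * p * V) ^ r := by
  have hXs : ∀ y, (X y).IsSymm := fun y => hX y ▸ isSymm_sum_smul (fun q => ζ q (y q)) hH
  have hA : ∀ v : ι → ℝ, v ⬝ᵥ (∑ q, H q * H q) *ᵥ v ≤ V * (v ⬝ᵥ v) := by
    intro v
    refine le_trans (le_of_eq ?_) (hV v)
    rw [sum_mulVec, dotProduct_sum]
    refine Finset.sum_congr rfl fun q _ => ?_
    rw [← mulVec_mulVec, dotProduct_mulVec, ← mulVec_transpose, (hH q).eq]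
  induction r with
  | zero =>
    simp only [mul_zero, pow_zero, trace_one, mul_one]
    rw [← Finset.sum_mul, sum_prodWeight μ h1, one_mul]
  | succ r ih =>
    have hw := prodWeight_nonneg μ hμ
    have ih := ih (by omega)
    have hr' : (r : ℝ) + 1 ≤ p := by exact_mod_cast hr
    set E := ∑ y, prodWeight μ y * trace (X y ^ (2 * r))
    have hE : 0 ≤ E :=
      Finset.sum_nonneg fun y _ => mul_nonneg (hw y) (trace_pow_nonneg (hXs y) (even_two_mul r))
    calc ∑ y, prodWeight μ y * trace (X y ^ (2 * (r + 1)))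
        = ∑ q, ∑ y, prodWeight μ y * (ζ q (y q) * trace (H q * X y ^ (2 * r + 1))) := by
          rw [Finset.sum_comm]
          refine Finset.sum_congr rfl fun y _ => ?_
          rw [← Finset.mul_sum]
          congr 1
          rw [show 2 * (r + 1) = (2 * r + 1) + 1 by ring, pow_succ']
          nth_rw 1 [hX y]
          rw [Finset.sum_mul, trace_sum]
          refine Finset.sum_congr rfl fun q _ => ?_
          rw [Matrix.smul_mul, trace_smul, smul_eq_mul]
      _ ≤ ∑ q, 2 * (2 * r + 1) * ∑ y, prodWeight μ y * trace (H q * H q * X y ^ (2 * r)) :=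
          Finset.sum_le_sum fun q _ =>
            sum_mul_trace_pow_succ_le X H ζ hμ h1 h0 hζ hζ' hH hX q r
      _ = 2 * (2 * r + 1) *
            ∑ y, prodWeight μ y * trace ((∑ q, H q * H q) * X y ^ (2 * r)) := by
          rw [← Finset.mul_sum, Finset.sum_comm]
          congr 1
          refine Finset.sum_congr rfl fun y _ => ?_
          rw [← Finset.mul_sum, Finset.sum_mul, trace_sum]
      _ ≤ 2 * (2 * r + 1) * ∑ y, prodWeight μ y * (V * trace (X y ^ (2 * r))) := by
          gcongr with y _
          · exact hw y
          · exact trace_mul_pow_le (hXs y) hA (even_two_mul r)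
      _ = 2 * (2 * r + 1) * V * E := by
          simp only [E, Finset.mul_sum]
          refine Finset.sum_congr rfl fun y _ => by ring
      -- As `r + 1 ≤ p`, the factor `2 * (2 * r + 1)` is at most `4 * p`; a base independent of `r`
      -- lets the induction close.
      _ ≤ 4 * p * V * (Fintype.card ι * (4 * p * V) ^ r) := by
          refine mul_le_mul (mul_le_mul_of_nonneg_right ?_ hV0) ih hE (by positivity)
          linarith
      _ = _ := by ring

/-- A tail bound for the operator norm of a sum of independent centred random matrices. -/
theorem sum_prodWeight_filter_le {μ} (hμ : ∀ q s, 0 ≤ μ q s) (h1 : ∀ q, ∑ s, μ q s = 1)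
    (h0 : ∀ q, ∑ s, μ q s * ζ q s = 0) (hζ : ∀ q s, |ζ q s| ≤ 1)
    (hζ' : ∀ q s s', |ζ q s - ζ q s'| ≤ 1) (hH : ∀ q, (H q).IsSymm)
    (hX : ∀ y, X y = ∑ q, ζ q (y q) • H q) {V : ℝ} (hV0 : 0 ≤ V)
    (hV : ∀ v, ∑ q, H q *ᵥ v ⬝ᵥ H q *ᵥ v ≤ V * (v ⬝ᵥ v)) {p : ℕ} (hp : p ≠ 0) {t : ℝ}
    (ht : 0 < t) (B : Finset (Q → S))
    (hB : ∀ y ∈ B, ∃ v, t ^ 2 * (v ⬝ᵥ v) < X y *ᵥ v ⬝ᵥ X y *ᵥ v) :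
    ∑ y ∈ B, prodWeight μ y ≤ Fintype.card ι * (4 * p * V / t ^ 2) ^ p := by
  have hXs : ∀ y, (X y).IsSymm := fun y => hX y ▸ isSymm_sum_smul (fun q => ζ q (y q)) hH
  have htr : ∀ y, 0 ≤ trace (X y ^ (2 * p)) := fun y =>
    trace_pow_nonneg (hXs y) (even_two_mul p)
  have hw := prodWeight_nonneg μ hμ
  rw [div_pow, mul_div_assoc', le_div_iff₀ (by positivity), ← pow_mul]
  refine le_trans ?_ (sum_trace_pow_le X H ζ hμ h1 h0 hζ hζ' hH hX hV0 hV le_rfl)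
  rw [Finset.sum_mul]
  refine le_trans (Finset.sum_le_sum fun y hy => ?_)
    (Finset.sum_le_sum_of_subset_of_nonneg (Finset.subset_univ B)
      fun y _ _ => mul_nonneg (hw y) (htr y))
  refine mul_le_mul_of_nonneg_left ?_ (hw y)
  -- Markov's inequality: on a bad configuration the trace moment is at least `t ^ (2 * p)`.
  by_contra! hlt
  obtain ⟨v, hv⟩ := hB y hy
  exact absurd (dotProduct_mulVec_self_le (hXs y) hp hlt.le v) (not_le.mpr hv)

end Exchange

end Moments

/-! ### The spectral gap and the Poincaré inequality. -/

section Gap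

open Matrix

variable {n : ℕ} (G : SimpleGraph (Fin n)) [DecidableRel G.Adj]

theorem sum_adjMatrix (i : Fin n) : ∑ j, G.adjMatrix ℝ i j = G.degree i := by
  simp [SimpleGraph.adjMatrix_apply, SimpleGraph.degree, SimpleGraph.neighborFinset_eq_filter]

theorem dirichlet_eq (f : Fin n → ℝ) :
    ∑ i, ∑ j, G.adjMatrix ℝ i j * (f i - f j) ^ 2 =
      2 * (∑ i, G.degree i * f i ^ 2 - ∑ i, ∑ j, f i * G.adjMatrix ℝ i j * f j) := by
  have h1 : ∑ i, ∑ j, G.adjMatrix ℝ i j * f i ^ 2 = ∑ i, G.degree i * f i ^ 2 :=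
    Finset.sum_congr rfl fun i _ => by rw [← Finset.sum_mul, sum_adjMatrix]
  have h2 : ∑ i, ∑ j, G.adjMatrix ℝ i j * f j ^ 2 = ∑ i, G.degree i * f i ^ 2 := by
    rw [Finset.sum_comm, ← h1]
    refine Finset.sum_congr rfl fun i _ => Finset.sum_congr rfl fun j _ => ?_
    rw [(G.isSymm_adjMatrix (α := ℝ)).apply]
  calc _ = ∑ i, ∑ j, (G.adjMatrix ℝ i j * f i ^ 2 + G.adjMatrix ℝ i j * f j ^ 2 -
        2 * (f i * G.adjMatrix ℝ i j * f j)) :=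
        Finset.sum_congr rfl fun i _ => Finset.sum_congr rfl fun j _ => by ring
    _ = _ := by
        simp only [Finset.sum_sub_distrib, Finset.sum_add_distrib, ← Finset.mul_sum]
        rw [h1, h2]
        ring

variable {G}

theorem walkMatrix_mulVec (hd : ∀ i, 0 < G.degree i) (f : Fin n → ℝ) (i : Fin n) :
    (walkMatrix G *ᵥ f) i = (G.degree i : ℝ)⁻¹ * (G.adjMatrix ℝ *ᵥ f) i := by
  have hinv : (diagonal fun i => (G.degree i : ℝ))⁻¹ = diagonal fun i => (G.degree i : ℝ)⁻¹ := by
    refine inv_eq_right_inv ?_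
    rw [diagonal_mul_diagonal, ← diagonal_one]
    congr 1
    ext i
    exact mul_inv_cancel₀ (by exact_mod_cast (hd i).ne')
  rw [walkMatrix, hinv, ← mulVec_mulVec, mulVec_diagonal]

theorem walkMatrix_mulVec_eq_smul_iff (hd : ∀ i, 0 < G.degree i) (f : Fin n → ℝ) (μ : ℝ) :
    walkMatrix G *ᵥ f = μ • f ↔ ∀ i, (G.adjMatrix ℝ *ᵥ f) i = μ * (G.degree i * f i) := by
  rw [funext_iff]
  refine forall_congr' fun i => ?_
  have : (G.degree i : ℝ) ≠ 0 := by exact_mod_cast (hd i).ne'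
  rw [walkMatrix_mulVec hd, inv_mul_eq_iff_eq_mul₀ this, Pi.smul_apply, smul_eq_mul]
  constructor <;> intro h <;> rw [h] <;> ring

variable (G) in
theorem finite_nonconstant_eigenvalues :
    {μ : ℝ | ∃ f : Fin n → ℝ, (∃ i j, f i ≠ f j) ∧ walkMatrix G *ᵥ f = μ • f}.Finite := by
  refine (Module.End.finite_hasEigenvalue (toLin' (walkMatrix G))).subset ?_
  rintro μ ⟨f, ⟨i, j, hij⟩, hf⟩
  refine Module.End.hasEigenvalue_of_hasEigenvector (x := f) ⟨?_, ?_⟩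
  · rw [Module.End.mem_eigenspace_iff, toLin'_apply, hf]
  · rintro rfl
    exact hij rfl

/-- The supremum is attained. A nonconstant eigenfunction with eigenvalue at least 1 would have zero
Dirichlet energy, hence be constant along edges and so on the connected graph. -/
theorem spectralGap_pos (hG : G.Connected) (hd : ∀ i, 0 < G.degree i) : 0 < spectralGap G := by
  rw [spectralGap, sub_pos]
  set s := {μ : ℝ | ∃ f : Fin n → ℝ, (∃ i j, f i ≠ f j) ∧ walkMatrix G *ᵥ f = μ • f} with hs
  rcases s.eq_empty_or_nonempty with h | h
  · rw [h, Real.sSup_empty]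
    exact one_pos
  obtain ⟨f, ⟨a, b, hab⟩, hf⟩ := h.csSup_mem (finite_nonconstant_eigenvalues G)
  by_contra! h1
  rw [walkMatrix_mulVec_eq_smul_iff hd] at hf
  set μ := sSup s
  have h0 : ∑ i, ∑ j, G.adjMatrix ℝ i j * (f i - f j) ^ 2 ≤ 0 := by
    have e : ∑ i, ∑ j, f i * G.adjMatrix ℝ i j * f j = μ * ∑ i, G.degree i * f i ^ 2 := by
      rw [Finset.mul_sum]
      refine Finset.sum_congr rfl fun i _ => ?_
      have := hf i
      rw [mulVec, dotProduct] at this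
      simp only [mul_assoc]
      rw [← Finset.mul_sum, this]
      ring
    rw [dirichlet_eq, e]
    have : 0 ≤ ∑ i, (G.degree i : ℝ) * f i ^ 2 := by positivity
    nlinarith
  have hA : ∀ i j, 0 ≤ G.adjMatrix ℝ i j * (f i - f j) ^ 2 := by
    intro i j
    rw [SimpleGraph.adjMatrix_apply]
    split_ifs <;> positivity
  have hadj : ∀ i j, G.Adj i j → f i = f j := by
    intro i j hij
    have h2 : G.adjMatrix ℝ i j * (f i - f j) ^ 2 ≤ 0 :=
      (Finset.single_le_sum (f := fun j => G.adjMatrix ℝ i j * (f i - f j) ^ 2)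
        (fun j _ => hA i j) (Finset.mem_univ j)).trans
      ((Finset.single_le_sum (f := fun i => ∑ j, G.adjMatrix ℝ i j * (f i - f j) ^ 2)
        (fun i _ => Finset.sum_nonneg fun j _ => hA i j) (Finset.mem_univ i)).trans h0)
    rw [SimpleGraph.adjMatrix_apply, if_pos hij, one_mul] at h2
    exact sub_eq_zero.mp (pow_eq_zero_iff two_ne_zero |>.mp (le_antisymm h2 (sq_nonneg _)))
  refine hab ?_
  obtain ⟨p⟩ := hG.preconnected a b
  clear hab
  induction p with
  | nil => rfl
  | cons h _ ih => exact (hadj _ _ h).trans ih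

/-- The Poincaré inequality for the random walk on a graph. -/
theorem spectralGap_mul_le (hd : ∀ i, 0 < G.degree i) (f : Fin n → ℝ) :
    ∃ c : ℝ, 2 * (spectralGap G * ∑ i, G.degree i * (f i - c) ^ 2) ≤
      ∑ i, ∑ j, G.adjMatrix ℝ i j * (f i - f j) ^ 2 := by
  have hdR : ∀ i, (0 : ℝ) < G.degree i := fun i => by exact_mod_cast hd i
  set s : Fin n → ℝ := fun i => Real.sqrt (G.degree i) with hs
  have hs0 : ∀ i, 0 < s i := fun i => Real.sqrt_pos.mpr (hdR i)
  have hss : ∀ i, s i * s i = G.degree i := fun i => Real.mul_self_sqrt (hdR i).le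
  set S : Matrix (Fin n) (Fin n) ℝ := Matrix.of fun i j => (s i)⁻¹ * G.adjMatrix ℝ i j * (s j)⁻¹
    with hS
  have hSs : S.IsSymm := by
    ext i j
    simp only [hS, transpose_apply, of_apply, (G.isSymm_adjMatrix (α := ℝ)).apply i j]
    ring
  obtain ⟨U, a, hU1, hU2, hSU⟩ := exists_orthogonal_diagonalization hSs
  -- The degree-weighted mean makes `f - c` orthogonal to the constants in the inner product in
  -- which the walk is self-adjoint.
  set c : ℝ := (∑ i, G.degree i * f i) / ∑ i, (G.degree i : ℝ) with hc
  have hcsum : ∑ i, (G.degree i : ℝ) * (f i - c) = 0 := by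
    rcases isEmpty_or_nonempty (Fin n) with h | h
    · simp
    have : (0 : ℝ) < ∑ i, (G.degree i : ℝ) := Finset.sum_pos (fun i _ => hdR i) Finset.univ_nonempty
    simp only [mul_sub, Finset.sum_sub_distrib, ← Finset.sum_mul]
    rw [hc]
    field_simp
    ring
  refine ⟨c, ?_⟩
  set g : Fin n → ℝ := fun i => s i * (f i - c) with hg
  set β : Fin n → ℝ := Uᵀ *ᵥ g with hβ
  have hgg : ∑ i, (G.degree i : ℝ) * (f i - c) ^ 2 = ∑ k, β k ^ 2 := by
    have h1 : β ⬝ᵥ β = g ⬝ᵥ g := by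
      rw [hβ, dotProduct_mulVec, vecMul_mulVec, transpose_transpose, hU1, vecMul_one]
    simp only [dotProduct] at h1
    calc _ = ∑ i, g i * g i := Finset.sum_congr rfl fun i _ => by
            rw [← hss]
            ring
      _ = _ := by
          rw [← h1]
          exact Finset.sum_congr rfl fun i _ => by ring
  have hgS : ∑ i, ∑ j, (f i - c) * G.adjMatrix ℝ i j * (f j - c) = ∑ k, a k * β k ^ 2 := by
    have h1 : g ⬝ᵥ S *ᵥ g = ∑ k, a k * β k ^ 2 := by
      rw [hSU, ← mulVec_mulVec, ← mulVec_mulVec, dotProduct_mulVec, ← mulVec_transpose, ← hβ]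
      simp only [dotProduct, mulVec_diagonal]
      exact Finset.sum_congr rfl fun i _ => by ring
    rw [← h1]
    simp only [dotProduct, mulVec, Finset.mul_sum]
    refine Finset.sum_congr rfl fun i _ => Finset.sum_congr rfl fun j _ => ?_
    have hi := (hs0 i).ne'
    have hj := (hs0 j).ne'
    simp only [hg, hS, of_apply]
    field_simp
  have hterm : ∀ k, a k * β k ^ 2 ≤ (1 - spectralGap G) * β k ^ 2 := by
    intro k
    set φ : Fin n → ℝ := fun i => (s i)⁻¹ * U i k with hφ
    have hcol : S *ᵥ Uᵀ k = a k • Uᵀ k := by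
      have h1 : S * U = U * diagonal a := by
        rw [hSU, Matrix.mul_assoc, hU2, Matrix.mul_one]
      ext i
      have h2 := congrFun (congrFun h1 i) k
      rw [mul_diagonal] at h2
      rw [Pi.smul_apply, smul_eq_mul, mul_comm]
      exact h2
    by_cases hconst : ∃ i j, φ i ≠ φ j
    -- Rescaling an eigenvector of the symmetrized matrix by inverse square roots of degrees gives
    -- one of the walk. If it is nonconstant, its eigenvalue is among those bounded by the supremum;
    -- otherwise the coefficient `β k` vanishes by `hcsum`.
    · refine mul_le_mul_of_nonneg_right ?_ (sq_nonneg _)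
      rw [spectralGap, sub_sub_cancel]
      refine le_csSup (finite_nonconstant_eigenvalues G).bddAbove ⟨φ, hconst, ?_⟩
      rw [walkMatrix_mulVec_eq_smul_iff hd]
      intro i
      have h1 := congrFun hcol i
      simp only [mulVec, dotProduct, hS, of_apply, Pi.smul_apply, smul_eq_mul,
        transpose_apply] at h1
      have hi := (hs0 i).ne'
      calc (G.adjMatrix ℝ *ᵥ φ) i
          = s i * ∑ j, (s i)⁻¹ * G.adjMatrix ℝ i j * (s j)⁻¹ * U j k := by
            rw [Finset.mul_sum, mulVec, dotProduct]
            refine Finset.sum_congr rfl fun j _ => ?_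
            simp only [hφ]
            field_simp
        _ = _ := by
            rw [h1, ← hss]
            simp only [hφ]
            field_simp
    · push Not at hconst
      have : β k = 0 := by
        have h1 : ∀ i, U i k = s i * φ k := by
          intro i
          rw [← hconst i k]
          simp only [hφ]
          rw [mul_inv_cancel_left₀ (hs0 i).ne']
        calc β k = ∑ i, U i k * g i := rfl
          _ = φ k * ∑ i, (G.degree i : ℝ) * (f i - c) := by
            rw [Finset.mul_sum]
            refine Finset.sum_congr rfl fun i _ => ?_
            rw [h1, ← hss]
            simp only [hg]
            ring
          _ = 0 := by rw [hcsum, mul_zero]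
      rw [this]
      simp
  have hdir := dirichlet_eq G fun i => f i - c
  simp only [sub_sub_sub_cancel_right] at hdir
  rw [hdir, hgS, hgg]
  have := Finset.sum_le_sum fun k (_ : k ∈ Finset.univ) => hterm k
  rw [← Finset.mul_sum] at this
  linarith

end Gap

/-! ### Stationary distributions and balance equations. -/

section Stationary

open Matrix

/-- A left fixed vector `v` exists because `T` fixes the constants. The triangle inequality gives
`|v| ≤ |v| T` entrywise, and both sides have the same total, so equality holds and `|v|` can be
normalized. Irreducibility is not needed. -/
theorem exists_isStationary {n : ℕ} [NeZero n] {T : Matrix (Fin n) (Fin n) ℝ}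
    (h0 : ∀ i j, 0 ≤ T i j) (h1 : ∀ i, ∑ j, T i j = 1) : ∃ π, IsStationary T π := by
  have hdet : (1 - T).det = 0 := by
    rw [← exists_mulVec_eq_zero_iff]
    refine ⟨fun _ => 1, fun h => one_ne_zero (congrFun h 0), ?_⟩
    rw [sub_mulVec, one_mulVec, sub_eq_zero]
    ext i
    simp [mulVec, dotProduct, h1]
  obtain ⟨v, hv0, hv⟩ := exists_vecMul_eq_zero_iff.mpr hdet
  rw [vecMul_sub, vecMul_one, sub_eq_zero] at hv
  have hle : ∀ j ∈ Finset.univ, |v j| ≤ ∑ i, |v i| * T i j := by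
    intro j _
    rw [congrFun hv j, vecMul, dotProduct]
    refine (Finset.abs_sum_le_sum_abs _ _).trans (le_of_eq ?_)
    exact Finset.sum_congr rfl fun i _ => by rw [abs_mul, abs_of_nonneg (h0 i j)]
  have hsum : ∑ j, |v j| = ∑ j, ∑ i, |v i| * T i j := by
    rw [Finset.sum_comm]
    exact Finset.sum_congr rfl fun i _ => by rw [← Finset.mul_sum, h1, mul_one]
  have heq := (Finset.sum_eq_sum_iff_of_le hle).mp hsum
  have hpos : 0 < ∑ j, |v j| := by
    obtain ⟨i, hi⟩ := Function.ne_iff.mp hv0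
    exact Finset.sum_pos' (fun _ _ => abs_nonneg _) ⟨i, Finset.mem_univ i, abs_pos.mpr hi⟩
  refine ⟨fun i => |v i| / ∑ j, |v j|, ⟨fun i => by positivity, ?_⟩, ?_⟩
  · rw [← Finset.sum_div, div_self hpos.ne']
  · ext j
    rw [heq j (Finset.mem_univ j), Finset.sum_div, vecMul, dotProduct]
    exact Finset.sum_congr rfl fun i _ => div_mul_eq_mul_div _ _ _

variable {n k : ℕ} {G : SimpleGraph (Fin n)} [DecidableRel G.Adj]

theorem ratio_nonneg (y : Outcomes G k) (i j : Fin n) : 0 ≤ ratio G y i j := by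
  unfold ratio
  positivity

theorem ratio_le_one (y : Outcomes G k) (i j : Fin n) : ratio G y i j ≤ 1 := by
  unfold ratio
  refine div_le_one_of_le₀ (Nat.cast_le.mpr ?_) k.cast_nonneg
  unfold wins
  split_ifs
  · exact (Finset.card_le_univ _).trans_eq (Fintype.card_fin k)
  · exact (Finset.card_le_univ _).trans_eq (Fintype.card_fin k)
  · exact k.zero_le

theorem ratio_eq_zero (y : Outcomes G k) {i j : Fin n} (h : ¬ G.Adj i j) : ratio G y i j = 0 := by
  have h' : ¬ G.Adj j i := fun h' => h h'.symm
  simp [ratio, wins, h, h']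

theorem transition_eq (y : Outcomes G k) (i j : Fin n) :
    transition G y i j = (if i = j then 1 - 1 / (G.maxDegree : ℝ) * ∑ l, ratio G y i l else 0) +
      1 / (G.maxDegree : ℝ) * ratio G y i j := by
  by_cases h : i = j
  · subst h
    have hz := ratio_eq_zero y (G.irrefl (v := i))
    simp [transition, hz]
  · simp [transition, h]

theorem sum_transition (y : Outcomes G k) (i : Fin n) : ∑ j, transition G y i j = 1 := by
  simp only [transition_eq, Finset.sum_add_distrib, Finset.sum_ite_eq, Finset.mem_univ, if_true,
    ← Finset.mul_sum]
  ring

theorem transition_nonneg (y : Outcomes G k) (i j : Fin n) : 0 ≤ transition G y i j := by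
  rw [transition_eq]
  have hr := ratio_nonneg y i j
  refine add_nonneg ?_ (by positivity)
  split_ifs
  · have hs : ∑ l, ratio G y i l ≤ G.maxDegree := by
      calc ∑ l, ratio G y i l ≤ ∑ l, G.adjMatrix ℝ i l := by
            refine Finset.sum_le_sum fun l _ => ?_
            rw [SimpleGraph.adjMatrix_apply]
            split_ifs with h
            · exact ratio_le_one y i l
            · exact (ratio_eq_zero y h).le
        _ = G.degree i := sum_adjMatrix G i
        _ ≤ _ := by exact_mod_cast G.degree_le_maxDegree i
    rw [sub_nonneg, one_div_mul_eq_div]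
    exact div_le_one_of_le₀ hs (by positivity)
  · exact le_rfl

theorem vecMul_transition_eq_iff (hD : 0 < G.maxDegree) (y : Outcomes G k) (x : Fin n → ℝ) :
    vecMul x (transition G y) = x ↔
      ∀ j, ∑ i, (x i * ratio G y i j - x j * ratio G y j i) = 0 := by
  rw [funext_iff]
  refine forall_congr' fun j => ?_
  have hD' : (G.maxDegree : ℝ) ≠ 0 := by exact_mod_cast hD.ne'
  have e : vecMul x (transition G y) j = x j +
      1 / (G.maxDegree : ℝ) * ∑ i, (x i * ratio G y i j - x j * ratio G y j i) := by
    simp only [vecMul, dotProduct, transition_eq, mul_add, Finset.sum_add_distrib, mul_ite,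
      mul_zero, Finset.sum_ite_eq', Finset.mem_univ, if_true, Finset.sum_sub_distrib,
      ← Finset.mul_sum]
    have : ∑ i, x i * (1 / (G.maxDegree : ℝ) * ratio G y i j) =
        1 / (G.maxDegree : ℝ) * ∑ i, x i * ratio G y i j := by
      rw [Finset.mul_sum]
      exact Finset.sum_congr rfl fun i _ => by ring
    rw [this]
    ring
  rw [e, add_eq_left, mul_eq_zero]
  simp [hD']

/-! ### Stability of the balance equations. -/

variable (G) in
/-- The deviation of the observed ratios from the Bradley--Terry probabilities. -/
def deviation (w : Fin n → ℝ) (y : Outcomes G k) (i j : Fin n) : ℝ :=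
  ratio G y i j - G.adjMatrix ℝ i j * (w j / (w i + w j))

variable (G) in
/-- The bilinear form that the deviations of the ratios induce. -/
def deviationForm (w : Fin n → ℝ) (y : Outcomes G k) (x f : Fin n → ℝ) : ℝ :=
  ∑ i, ∑ j, x i * deviation G w y i j * (f j - f i)

/-- By reversibility the contribution of `s * w` to the unperturbed flow cancels, and that of `w *
f` is a symmetric conductance times `f i - f j`. Summation by parts against `f` gives the identity.
-/
theorem energy_eq {w : Fin n → ℝ} (hw : ∀ i, 0 < w i) (y : Outcomes G k) {x f : Fin n → ℝ}
    {s : ℝ} (hx : ∀ j, ∑ i, (x i * ratio G y i j - x j * ratio G y j i) = 0)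
    (hf : ∀ i, x i = w i * (f i + s)) :
    ∑ i, ∑ j, G.adjMatrix ℝ i j * (w i * w j / (w i + w j)) * (f i - f j) ^ 2 =
      2 * deviationForm G w y x f := by
  set c : Fin n → Fin n → ℝ := fun i j => G.adjMatrix ℝ i j * (w i * w j / (w i + w j)) with hc
  have hsymm : ∀ i j, c i j = c j i := by
    intro i j
    simp only [hc]
    rw [(G.isSymm_adjMatrix (α := ℝ)).apply, add_comm (w i), mul_comm (w i)]
  have hflow : ∀ i j, x i * ratio G y i j - x j * ratio G y j i =
      c i j * (f i - f j) + (x i * deviation G w y i j - x j * deviation G w y j i) := by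
    intro i j
    have hij := (add_pos (hw i) (hw j)).ne'
    simp only [deviation, hc, (G.isSymm_adjMatrix (α := ℝ)).apply i j, add_comm (w j) (w i)]
    rw [hf i, hf j]
    field_simp
    ring
  have h1 : ∑ j, ∑ i, f j * (c i j * (f i - f j) +
      (x i * deviation G w y i j - x j * deviation G w y j i)) = 0 := by
    refine Finset.sum_eq_zero fun j _ => ?_
    rw [← Finset.mul_sum, ← Finset.sum_congr rfl fun i _ => hflow i j, hx, mul_zero]
  have h2 : ∑ j, ∑ i, f j * (x i * deviation G w y i j - x j * deviation G w y j i) =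
      deviationForm G w y x f := by
    have e : ∑ j, ∑ i, f j * (x j * deviation G w y j i) =
        ∑ j, ∑ i, f i * (x i * deviation G w y i j) := Finset.sum_comm
    simp only [mul_sub, Finset.sum_sub_distrib]
    rw [e]
    simp only [← Finset.sum_sub_distrib]
    rw [Finset.sum_comm]
    exact Finset.sum_congr rfl fun i _ => Finset.sum_congr rfl fun j _ => by ring
  have h3 : ∑ i, ∑ j, c i j * (f i - f j) ^ 2 = -2 * ∑ j, ∑ i, f j * (c i j * (f i - f j)) := by
    have e : ∑ j, ∑ i, f j * (c i j * (f i - f j)) = ∑ j, ∑ i, f i * (c i j * (f j - f i)) := by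
      rw [Finset.sum_comm]
      exact Finset.sum_congr rfl fun i _ => Finset.sum_congr rfl fun j _ => by rw [hsymm]
    have e2 : ∑ i, ∑ j, c i j * (f i - f j) ^ 2 =
        -(∑ j, ∑ i, f j * (c i j * (f i - f j))) - ∑ j, ∑ i, f i * (c i j * (f j - f i)) := by
      rw [Finset.sum_comm]
      simp only [← Finset.sum_neg_distrib, ← Finset.sum_sub_distrib]
      exact Finset.sum_congr rfl fun i _ => Finset.sum_congr rfl fun j _ => by ring
    rw [e2, ← e]
    ring
  simp only [mul_add, Finset.sum_add_distrib] at h1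
  rw [h2] at h1
  rw [h3]
  linarith

theorem deviationForm_add_smul (w : Fin n → ℝ) (y : Outcomes G k) (x x' f : Fin n → ℝ) (s : ℝ) :
    deviationForm G w y (fun i => x i + s * x' i) f =
      deviationForm G w y x f + s * deviationForm G w y x' f := by
  simp only [deviationForm, Finset.mul_sum, ← Finset.sum_add_distrib]
  exact Finset.sum_congr rfl fun i _ => Finset.sum_congr rfl fun j _ => by ring

/-- The stability of the flow balance equations of the Bradley--Terry chain: for a solution `x`
of the perturbed equations, `x - s w` is small if it has zero sum. -/
theorem sqrt_sum_sq_sub_le {w : Fin n → ℝ} (hw : ∀ i, 0 < w i) {b : ℝ} (hb : 0 < b)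
    (hwb : ∀ i, w i ∈ Set.Icc (1 / b) 1) (hd : ∀ i, 0 < G.degree i) (hγ : 0 < spectralGap G)
    (y : Outcomes G k) {K : ℝ} (hK0 : 0 ≤ K)
    (hK : ∀ x f, deviationForm G w y x f ≤
      K * (Real.sqrt (∑ i, x i ^ 2) * Real.sqrt (∑ i, f i ^ 2)))
    (hKb : K ≤ spectralGap G * G.minDegree / (4 * (b * Real.sqrt b)))
    {x : Fin n → ℝ} {s : ℝ} (hs : 0 ≤ s)
    (hx : ∀ j, ∑ i, (x i * ratio G y i j - x j * ratio G y j i) = 0)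
    (hsum : ∑ i, (x i - s * w i) = 0) :
    Real.sqrt (∑ i, (x i - s * w i) ^ 2) * (spectralGap G * G.minDegree) ≤
      4 * (b * Real.sqrt b) * K * s * Real.sqrt n := by
  set h : Fin n → ℝ := fun i => x i - s * w i with hh
  set f : Fin n → ℝ := fun i => h i / w i with hf
  have hwf : ∀ i, w i * f i = h i := fun i => mul_div_cancel₀ _ (hw i).ne'
  set N := Real.sqrt (∑ i, w i * f i ^ 2) with hN
  have hN0 : 0 ≤ N := Real.sqrt_nonneg _
  have hNsq : N ^ 2 = ∑ i, w i * f i ^ 2 :=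
    Real.sq_sqrt (Finset.sum_nonneg fun i _ => mul_nonneg (hw i).le (sq_nonneg _))
  have hhN : Real.sqrt (∑ i, h i ^ 2) ≤ N := by
    refine Real.sqrt_le_sqrt (Finset.sum_le_sum fun i _ => ?_)
    rw [← hwf, mul_pow]
    have h1 := (hwb i).2
    have h2 := (hw i).le
    have : w i ^ 2 ≤ w i := by nlinarith
    exact mul_le_mul_of_nonneg_right this (sq_nonneg _)
  have hbw : ∀ i, 1 ≤ b * w i := by
    intro i
    have := (hwb i).1
    rwa [div_le_iff₀' hb] at this
  have hfN : Real.sqrt (∑ i, f i ^ 2) ≤ Real.sqrt b * N := by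
    rw [hN, ← Real.sqrt_mul hb.le, Finset.mul_sum]
    refine Real.sqrt_le_sqrt (Finset.sum_le_sum fun i _ => ?_)
    rw [← mul_assoc]
    exact le_mul_of_one_le_left (sq_nonneg _) (hbw i)
  have hwn : Real.sqrt (∑ i, w i ^ 2) ≤ Real.sqrt n := by
    refine Real.sqrt_le_sqrt ?_
    calc ∑ i, w i ^ 2 ≤ ∑ _i : Fin n, (1 : ℝ) := Finset.sum_le_sum fun i _ =>
          pow_le_one₀ (hw i).le (hwb i).2
      _ = n := by simp
  have hform : deviationForm G w y x f ≤ K * ((N + s * Real.sqrt n) * (Real.sqrt b * N)) := by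
    have e : x = fun i => h i + s * w i := by
      ext i
      simp [hh]
    rw [e, deviationForm_add_smul]
    have h1 : deviationForm G w y h f ≤ K * (N * (Real.sqrt b * N)) :=
      (hK h f).trans (by gcongr)
    have h2 : s * deviationForm G w y w f ≤ s * (K * (Real.sqrt n * (Real.sqrt b * N))) :=
      mul_le_mul_of_nonneg_left ((hK w f).trans (by gcongr)) hs
    linarith
  have henergy := energy_eq (f := f) (s := s) hw y hx fun i => by
    rw [mul_add, hwf]
    simp only [hh]
    ring
  obtain ⟨c, hc⟩ := spectralGap_mul_le hd f
  -- The `w`-weighted mean of `f` is zero because `h` has zero sum, so recentring at the Poincaré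
  -- constant `c` can only increase the weighted sum of squares.
  have hvar : N ^ 2 ≤ ∑ i, (f i - c) ^ 2 := by
    have hwfsum : ∑ i, w i * f i = 0 := by simpa only [hwf] using hsum
    calc N ^ 2 ≤ N ^ 2 + c ^ 2 * ∑ i, w i := by
          have : 0 ≤ ∑ i, w i := Finset.sum_nonneg fun i _ => (hw i).le
          have := mul_nonneg (sq_nonneg c) this
          linarith
      _ = N ^ 2 - 2 * c * ∑ i, w i * f i + c ^ 2 * ∑ i, w i := by rw [hwfsum]; ring
      _ = ∑ i, w i * (f i - c) ^ 2 := by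
          rw [hNsq, Finset.mul_sum, Finset.mul_sum, ← Finset.sum_sub_distrib,
            ← Finset.sum_add_distrib]
          exact Finset.sum_congr rfl fun i _ => by ring
      _ ≤ _ := Finset.sum_le_sum fun i _ =>
          mul_le_of_le_one_left (sq_nonneg _) (hwb i).2
  have hdeg : G.minDegree * N ^ 2 ≤ ∑ i, (G.degree i : ℝ) * (f i - c) ^ 2 := by
    refine (mul_le_mul_of_nonneg_left hvar (by positivity)).trans ?_
    rw [Finset.mul_sum]
    refine Finset.sum_le_sum fun i _ => mul_le_mul_of_nonneg_right ?_ (sq_nonneg _)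
    exact_mod_cast G.minDegree_le_degree i
  have hcond : ∑ i, ∑ j, G.adjMatrix ℝ i j * (f i - f j) ^ 2 ≤ 2 * b *
      ∑ i, ∑ j, G.adjMatrix ℝ i j * (w i * w j / (w i + w j)) * (f i - f j) ^ 2 := by
    simp only [Finset.mul_sum]
    refine Finset.sum_le_sum fun i _ => Finset.sum_le_sum fun j _ => ?_
    have hA : 0 ≤ G.adjMatrix ℝ i j := by
      rw [SimpleGraph.adjMatrix_apply]
      split_ifs <;> norm_num
    have h1 : 1 ≤ 2 * b * (w i * w j / (w i + w j)) := by
      rw [mul_div_assoc', le_div_iff₀ (add_pos (hw i) (hw j))]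
      have h2 := mul_le_mul_of_nonneg_right (hbw i) (hw j).le
      have h3 := mul_le_mul_of_nonneg_right (hbw j) (hw i).le
      linarith
    have := mul_le_mul_of_nonneg_left h1 (mul_nonneg hA (sq_nonneg (f i - f j)))
    linarith
  rw [henergy] at hcond
  set g := spectralGap G * G.minDegree with hg
  have hmain : g * N ^ 2 ≤ 2 * b * (K * ((N + s * Real.sqrt n) * (Real.sqrt b * N))) := by
    have h1 := mul_le_mul_of_nonneg_left hdeg hγ.le
    have h2 := mul_le_mul_of_nonneg_left hform (by positivity : 0 ≤ 2 * b)
    rw [← mul_assoc, ← hg] at h1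
    linarith
  have hsb : 0 < b * Real.sqrt b := mul_pos hb (Real.sqrt_pos.mpr hb)
  rw [le_div_iff₀ (by positivity)] at hKb
  have hg0 : 0 ≤ g := mul_nonneg hγ.le (Nat.cast_nonneg _)
  have hRHS : 0 ≤ 4 * (b * Real.sqrt b) * K * s * Real.sqrt n := by positivity
  refine (mul_le_mul_of_nonneg_right hhN hg0).trans ?_
  rcases hN0.eq_or_lt with h0 | h0
  · rw [← h0, zero_mul]
    exact hRHS
  · have h1 : g * N ≤ 2 * (b * Real.sqrt b) * K * (N + s * Real.sqrt n) := by
      refine le_of_mul_le_mul_right ?_ h0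
      calc g * N * N = g * N ^ 2 := by ring
        _ ≤ _ := hmain
        _ = _ := by ring
    -- The assumed bound on `K` makes the term linear in `N` on the right at most `g * N / 2`, so it
    -- is absorbed on the left.
    have h2 := mul_le_mul_of_nonneg_right hKb h0.le
    linarith

/-- If the deviations are small in operator norm, then the estimate exists and is accurate. -/
theorem exists_isEstimate [NeZero n] {w : Fin n → ℝ} (hw : ∀ i, 0 < w i) {b : ℝ} (hb : 0 < b)
    (hwb : ∀ i, w i ∈ Set.Icc (1 / b) 1) (hd : ∀ i, 0 < G.degree i) (hγ : 0 < spectralGap G)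
    (y : Outcomes G k) {K : ℝ} (hK0 : 0 ≤ K)
    (hK : ∀ x f, deviationForm G w y x f ≤
      K * (Real.sqrt (∑ i, x i ^ 2) * Real.sqrt (∑ i, f i ^ 2)))
    (hKb : K ≤ spectralGap G * G.minDegree / (4 * (b * Real.sqrt b))) :
    ∃ π, IsEstimate G y π ∧
      Real.sqrt (∑ i, (weights w π i - w i) ^ 2) * (spectralGap G * G.minDegree) ≤
        4 * (b * Real.sqrt b) * K * Real.sqrt n := by
  have hD : 0 < G.maxDegree := (hd 0).trans_le (G.degree_le_maxDegree 0)
  obtain ⟨π, hπ⟩ := exists_isStationary (transition_nonneg y) (sum_transition y)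
  have hflow : ∀ {π}, IsStationary (transition G y) π →
      ∀ j, ∑ i, (π i * ratio G y i j - π j * ratio G y j i) = 0 :=
    fun h => (vecMul_transition_eq_iff hD y _).mp h.2
  have hmin : 0 < G.minDegree := by
    obtain ⟨v, hv⟩ := G.exists_minimal_degree_vertex
    exact hv ▸ hd v
  have hg : 0 < spectralGap G * G.minDegree := mul_pos hγ (by exact_mod_cast hmin)
  refine ⟨π, ⟨hπ, fun π' hπ' => ?_⟩, ?_⟩
  -- With `s = 0` the stability bound is zero, so two stationary distributions coincide.
  · have h := sqrt_sum_sq_sub_le hw hb hwb hd hγ y hK0 hK hKb (x := fun i => π' i - π i)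
      (s := 0) le_rfl
      (fun j => by
        have h1 := hflow hπ j
        have h2 := hflow hπ' j
        calc _ = ∑ i, (π' i * ratio G y i j - π' j * ratio G y j i) -
              ∑ i, (π i * ratio G y i j - π j * ratio G y j i) := by
              rw [← Finset.sum_sub_distrib]
              exact Finset.sum_congr rfl fun i _ => by ring
          _ = 0 := by rw [h1, h2, sub_zero])
      (by simp [Finset.sum_sub_distrib, hπ.1.2, hπ'.1.2])
    simp only [zero_mul, mul_zero, sub_zero] at h
    have h0 : ∑ i, (π' i - π i) ^ 2 ≤ 0 :=
      Real.sqrt_eq_zero'.mp (le_antisymm (nonpos_of_mul_nonpos_left h hg) (Real.sqrt_nonneg _))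
    ext i
    have h1 := (Finset.sum_eq_zero_iff_of_nonneg fun i _ => sq_nonneg (π' i - π i)).mp
      (le_antisymm h0 (Finset.sum_nonneg fun i _ => sq_nonneg _)) i (Finset.mem_univ i)
    exact sub_eq_zero.mp (pow_eq_zero_iff two_ne_zero |>.mp h1)
  · have h := sqrt_sum_sq_sub_le hw hb hwb hd hγ y hK0 hK hKb (x := weights w π)
      (s := 1) zero_le_one
      (fun j => by
        have h1 := hflow hπ j
        calc _ = (∑ j, w j) * ∑ i, (π i * ratio G y i j - π j * ratio G y j i) := by
              rw [Finset.mul_sum]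
              refine Finset.sum_congr rfl fun i _ => ?_
              simp only [weights]
              ring
          _ = 0 := by rw [h1, mul_zero])
      (by simp [weights, Finset.sum_sub_distrib, ← Finset.mul_sum, hπ.1.2])
    simpa only [one_mul, mul_one] using h

end Stationary

/-! ### Concentration of the noise matrix. -/

section Concentration

open Matrix

variable {n k : ℕ} {G : SimpleGraph (Fin n)}

variable (G) in
/-- The Bradley--Terry probability of the outcome `s` of a comparison of the pair `q.1`. -/
def outcomeProb (w : Fin n → ℝ) (q : Pair G × Fin k) (s : Bool) : ℝ :=
  if s then w q.1.1.1 / (w q.1.1.1 + w q.1.1.2) else 1 - w q.1.1.1 / (w q.1.1.1 + w q.1.1.2)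

variable (G) in
/-- The centred outcome of a comparison. -/
def noise (w : Fin n → ℝ) (q : Pair G × Fin k) (s : Bool) : ℝ :=
  (if s then 1 else 0) - w q.1.1.1 / (w q.1.1.1 + w q.1.1.2)

theorem winProb_mem {w : Fin n → ℝ} (hw : ∀ i, 0 < w i) (i j : Fin n) :
    w i / (w i + w j) ∈ Set.Icc (0 : ℝ) 1 := by
  have hi := hw i
  have hj := hw j
  exact ⟨by positivity, div_le_one_of_le₀ (by linarith) (by positivity)⟩

theorem outcomeProb_nonneg {w : Fin n → ℝ} (hw : ∀ i, 0 < w i) (q : Pair G × Fin k) (s : Bool) :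
    0 ≤ outcomeProb G w q s := by
  obtain ⟨h0, h1⟩ := winProb_mem hw q.1.1.1 q.1.1.2
  unfold outcomeProb
  split_ifs <;> linarith

theorem sum_outcomeProb (w : Fin n → ℝ) (q : Pair G × Fin k) : ∑ s, outcomeProb G w q s = 1 := by
  simp [outcomeProb]

theorem sum_outcomeProb_mul_noise (w : Fin n → ℝ) (q : Pair G × Fin k) :
    ∑ s, outcomeProb G w q s * noise G w q s = 0 := by
  simp only [outcomeProb, noise, Fintype.sum_bool, if_true, Bool.false_eq_true, if_false]
  ring

theorem abs_noise_le {w : Fin n → ℝ} (hw : ∀ i, 0 < w i) (q : Pair G × Fin k) (s : Bool) :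
    |noise G w q s| ≤ 1 := by
  obtain ⟨h0, h1⟩ := winProb_mem hw q.1.1.1 q.1.1.2
  unfold noise
  rw [abs_le]
  split_ifs <;> constructor <;> linarith

theorem abs_noise_sub_le (w : Fin n → ℝ) (q : Pair G × Fin k) (s s' : Bool) :
    |noise G w q s - noise G w q s'| ≤ 1 := by
  unfold noise
  rw [sub_sub_sub_cancel_right]
  cases s <;> cases s' <;> norm_num

variable (G) in
/-- The vector `e i + e j` of a pair `(i, j)`, in the first summand. -/
def sumVec (p : Pair G) : Fin n ⊕ Fin n → ℝ :=
  Sum.elim (Pi.single p.1.1 1 + Pi.single p.1.2 1) 0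

variable (G) in
/-- The vector `e i - e j` of a pair `(i, j)`, in the second summand. -/
def diffVec (p : Pair G) : Fin n ⊕ Fin n → ℝ :=
  Sum.elim 0 (Pi.single p.1.1 1 - Pi.single p.1.2 1)

variable (G) in
/-- The Hermitian dilation of the contribution of a pair to the Rank Centrality matrix. -/
def pairMatrix (p : Pair G) : Matrix (Fin n ⊕ Fin n) (Fin n ⊕ Fin n) ℝ :=
  vecMulVec (sumVec G p) (diffVec G p) + vecMulVec (diffVec G p) (sumVec G p)

theorem isSymm_pairMatrix (p : Pair G) : (pairMatrix G p).IsSymm := by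
  rw [Matrix.IsSymm, pairMatrix, transpose_add, transpose_vecMulVec, transpose_vecMulVec,
    add_comm]

theorem sumVec_dotProduct (p : Pair G) (v : Fin n ⊕ Fin n → ℝ) :
    sumVec G p ⬝ᵥ v = v (Sum.inl p.1.1) + v (Sum.inl p.1.2) := by
  simp [sumVec, dotProduct, add_mul, Finset.sum_add_distrib, Pi.single_apply]

theorem diffVec_dotProduct (p : Pair G) (v : Fin n ⊕ Fin n → ℝ) :
    diffVec G p ⬝ᵥ v = v (Sum.inr p.1.1) - v (Sum.inr p.1.2) := by
  simp [diffVec, dotProduct, sub_mul, Finset.sum_sub_distrib, Pi.single_apply]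

theorem pairMatrix_mulVec (p : Pair G) (v : Fin n ⊕ Fin n → ℝ) :
    pairMatrix G p *ᵥ v =
      (diffVec G p ⬝ᵥ v) • sumVec G p + (sumVec G p ⬝ᵥ v) • diffVec G p := by
  rw [pairMatrix, add_mulVec, vecMulVec_mulVec, vecMulVec_mulVec]
  simp

/-- `sumVec` and `diffVec` are orthogonal with squared length 2. Keeping the bound local to the two
endpoints makes the sum over all pairs cost only the maximum degree. -/
theorem pairMatrix_mulVec_dotProduct_self_le (p : Pair G) (v : Fin n ⊕ Fin n → ℝ) :
    pairMatrix G p *ᵥ v ⬝ᵥ pairMatrix G p *ᵥ v ≤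
      4 * ((v (Sum.inl p.1.1) ^ 2 + v (Sum.inr p.1.1) ^ 2) +
        (v (Sum.inl p.1.2) ^ 2 + v (Sum.inr p.1.2) ^ 2)) := by
  have hne : p.1.1 ≠ p.1.2 := p.2.1.ne
  have h1 : sumVec G p ⬝ᵥ sumVec G p = 2 := by
    rw [sumVec_dotProduct]
    simp [sumVec, hne, hne.symm]
    norm_num
  have h2 : diffVec G p ⬝ᵥ diffVec G p = 2 := by
    rw [diffVec_dotProduct]
    simp [diffVec, hne, hne.symm]
    norm_num
  have h3 : sumVec G p ⬝ᵥ diffVec G p = 0 := by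
    rw [sumVec_dotProduct]
    simp [diffVec]
  have h4 : diffVec G p ⬝ᵥ sumVec G p = 0 := by rw [dotProduct_comm, h3]
  rw [pairMatrix_mulVec]
  simp only [add_dotProduct, dotProduct_add, smul_dotProduct, dotProduct_smul, h1, h2, h3, h4,
    smul_eq_mul]
  rw [sumVec_dotProduct, diffVec_dotProduct]
  nlinarith [sq_nonneg (v (Sum.inl p.1.1) - v (Sum.inl p.1.2)),
    sq_nonneg (v (Sum.inr p.1.1) + v (Sum.inr p.1.2))]

variable [DecidableRel G.Adj]

theorem sum_pair (F : Fin n → Fin n → ℝ) :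
    ∑ p : Pair G, (F p.1.1 p.1.2 + F p.1.2 p.1.1) = ∑ i, ∑ j, G.adjMatrix ℝ i j * F i j := by
  have hsub : ∀ F : Fin n → Fin n → ℝ, ∑ p : Pair G, F p.1.1 p.1.2 =
      ∑ i, ∑ j, if i < j ∧ G.Adj i j then F i j else 0 := by
    intro F
    rw [← Fintype.sum_prod_type', ← Finset.sum_filter]
    exact (Finset.sum_subtype _ (fun p => by simp) fun p : Fin n × Fin n => F p.1 p.2).symm
  rw [Finset.sum_add_distrib, hsub F, hsub fun i j => F j i]
  rw [Finset.sum_comm (f := fun i j => if i < j ∧ G.Adj i j then F j i else 0)]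
  simp only [← Finset.sum_add_distrib]
  refine Finset.sum_congr rfl fun i _ => Finset.sum_congr rfl fun j _ => ?_
  rw [SimpleGraph.adjMatrix_apply]
  simp only [G.adj_comm j i]
  by_cases h : G.Adj i j
  · rcases lt_or_gt_of_ne h.ne with hij | hij
    · simp [h, hij, hij.not_gt]
    · simp [h, hij, hij.not_gt]
  · simp [h]

variable (G k) in
theorem sum_pairMatrix_le (v : Fin n ⊕ Fin n → ℝ) :
    ∑ q : Pair G × Fin k, pairMatrix G q.1 *ᵥ v ⬝ᵥ pairMatrix G q.1 *ᵥ v ≤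
      4 * k * G.maxDegree * (v ⬝ᵥ v) := by
  rw [Fintype.sum_prod_type]
  simp only [Finset.sum_const, Finset.card_univ, Fintype.card_fin, nsmul_eq_mul]
  rw [← Finset.mul_sum]
  set g : Fin n → ℝ := fun i => v (Sum.inl i) ^ 2 + v (Sum.inr i) ^ 2 with hg
  have h1 : ∑ p : Pair G, pairMatrix G p *ᵥ v ⬝ᵥ pairMatrix G p *ᵥ v ≤
      4 * ∑ p : Pair G, (g p.1.1 + g p.1.2) := by
    rw [Finset.mul_sum]
    exact Finset.sum_le_sum fun p _ => pairMatrix_mulVec_dotProduct_self_le p v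
  have h2 : ∑ p : Pair G, (g p.1.1 + g p.1.2) ≤ G.maxDegree * (v ⬝ᵥ v) := by
    rw [sum_pair fun i _ => g i]
    simp only [← Finset.sum_mul, sum_adjMatrix]
    calc ∑ i, (G.degree i : ℝ) * g i ≤ ∑ i, (G.maxDegree : ℝ) * g i := by
          refine Finset.sum_le_sum fun i _ => mul_le_mul_of_nonneg_right ?_ (by positivity)
          exact_mod_cast G.degree_le_maxDegree i
      _ = _ := by
          simp only [← Finset.mul_sum, dotProduct, Fintype.sum_sum_type, hg,
            Finset.sum_add_distrib, pow_two]
  have h3 : (0 : ℝ) ≤ k := k.cast_nonneg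
  nlinarith [mul_le_mul_of_nonneg_left h1 h3, mul_le_mul_of_nonneg_left h2 h3]

variable (G) in
/-- The noise matrix: the dilation of `k` times the deviations. -/
def noiseMatrix (w : Fin n → ℝ) (y : Outcomes G k) :
    Matrix (Fin n ⊕ Fin n) (Fin n ⊕ Fin n) ℝ :=
  ∑ q, noise G w q (y q) • pairMatrix G q.1

theorem mul_deviation {w : Fin n → ℝ} (hw : ∀ i, 0 < w i) (hk : 0 < k) (y : Outcomes G k)
    (p : Pair G) :
    k * deviation G w y p.1.2 p.1.1 = ∑ m, noise G w (p, m) (y (p, m)) ∧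
      k * deviation G w y p.1.1 p.1.2 = -∑ m, noise G w (p, m) (y (p, m)) := by
  obtain ⟨⟨i, j⟩, hij, hadj⟩ := p
  have hk' : (k : ℝ) ≠ 0 := by exact_mod_cast hk.ne'
  have hwij := (add_pos (hw i) (hw j)).ne'
  have hnot : ¬ (j < i ∧ G.Adj j i) := fun h => h.1.not_gt hij
  simp only [noise, Finset.sum_sub_distrib, Finset.sum_const, Finset.card_univ, Fintype.card_fin,
    nsmul_eq_mul, deviation, ratio, SimpleGraph.adjMatrix_apply, if_pos hadj, if_pos hadj.symm,
    one_mul]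
  have htrue : (wins G y i j : ℝ) =
      ∑ m, if y (⟨(i, j), hij, hadj⟩, m) = true then (1 : ℝ) else 0 := by
    rw [wins, dif_pos ⟨hij, hadj⟩]
    simp
  have hfalse : (wins G y j i : ℝ) =
      k - ∑ m, if y (⟨(i, j), hij, hadj⟩, m) = true then (1 : ℝ) else 0 := by
    rw [wins, dif_neg hnot, dif_pos ⟨hij, hadj⟩]
    have : (k : ℝ) = ∑ _m : Fin k, (1 : ℝ) := by simp
    rw [this, ← Finset.sum_sub_distrib, Finset.card_filter]
    push_cast
    refine Finset.sum_congr rfl fun m _ => ?_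
    cases y (⟨(i, j), hij, hadj⟩, m) <;> simp
  constructor
  · rw [htrue, add_comm (w j)]
    field_simp
  · rw [hfalse]
    field_simp
    ring

/-- The deviations of the two orientations of a pair are opposite, so its two terms combine into a
multiple of `(x i + x j) * (f i - f j)`. This rank-one form is what `sumVec` and `diffVec` encode.
-/
theorem mul_deviationForm {w : Fin n → ℝ} (hw : ∀ i, 0 < w i) (hk : 0 < k) (y : Outcomes G k)
    (x f : Fin n → ℝ) :
    k * deviationForm G w y x f =
      (Sum.elim x 0 : Fin n ⊕ Fin n → ℝ) ⬝ᵥ noiseMatrix G w y *ᵥ Sum.elim 0 f := by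
  have h1 : deviationForm G w y x f =
      ∑ i, ∑ j, G.adjMatrix ℝ i j * (x i * deviation G w y i j * (f j - f i)) := by
    refine Finset.sum_congr rfl fun i _ => Finset.sum_congr rfl fun j _ => ?_
    rw [SimpleGraph.adjMatrix_apply]
    split_ifs with h
    · rw [one_mul]
    · simp [deviation, SimpleGraph.adjMatrix_apply, h, ratio_eq_zero y h]
  rw [h1, ← sum_pair, noiseMatrix, sum_mulVec, dotProduct_sum, Fintype.sum_prod_type,
    Finset.mul_sum]
  refine Finset.sum_congr rfl fun p _ => ?_
  obtain ⟨h2, h3⟩ := mul_deviation hw hk y p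
  have h4 : ∀ m, (Sum.elim x 0 : Fin n ⊕ Fin n → ℝ) ⬝ᵥ
      (noise G w (p, m) (y (p, m)) • pairMatrix G p) *ᵥ Sum.elim 0 f =
      noise G w (p, m) (y (p, m)) * ((x p.1.1 + x p.1.2) * (f p.1.1 - f p.1.2)) := by
    intro m
    rw [smul_mulVec, dotProduct_smul, pairMatrix_mulVec, dotProduct_add, dotProduct_smul,
      dotProduct_smul, dotProduct_comm _ (sumVec G p), dotProduct_comm _ (diffVec G p)]
    simp only [sumVec_dotProduct, diffVec_dotProduct, smul_eq_mul, Sum.elim_inl, Sum.elim_inr,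
      Pi.zero_apply]
    ring
  simp only [h4]
  rw [← Finset.sum_mul, ← h2]
  have h5 : k * deviation G w y p.1.1 p.1.2 = -(k * deviation G w y p.1.2 p.1.1) := by
    rw [h3, h2]
  linear_combination (x p.1.1 * (f p.1.2 - f p.1.1)) * h5

theorem deviationForm_le {w : Fin n → ℝ} (hw : ∀ i, 0 < w i) (hk : 0 < k) (y : Outcomes G k)
    {t : ℝ} (ht : 0 ≤ t)
    (h : ∀ v, noiseMatrix G w y *ᵥ v ⬝ᵥ noiseMatrix G w y *ᵥ v ≤ t ^ 2 * (v ⬝ᵥ v))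
    (x f : Fin n → ℝ) :
    deviationForm G w y x f ≤
      t / k * (Real.sqrt (∑ i, x i ^ 2) * Real.sqrt (∑ i, f i ^ 2)) := by
  have hk' : (0 : ℝ) < k := by exact_mod_cast hk
  rw [div_mul_eq_mul_div, le_div_iff₀' hk', mul_deviationForm hw hk]
  set u : Fin n ⊕ Fin n → ℝ := Sum.elim x 0
  set z : Fin n ⊕ Fin n → ℝ := noiseMatrix G w y *ᵥ Sum.elim 0 f with hz
  have hu : ∑ i, u i ^ 2 = ∑ i, x i ^ 2 := by simp [u]
  have hzf : Real.sqrt (∑ i, z i ^ 2) ≤ t * Real.sqrt (∑ i, f i ^ 2) := by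
    rw [← Real.sqrt_sq ht, ← Real.sqrt_mul (sq_nonneg t)]
    refine Real.sqrt_le_sqrt ?_
    have := h (Sum.elim 0 f)
    rw [← hz] at this
    simpa [dotProduct, ← pow_two] using this
  calc u ⬝ᵥ z ≤ Real.sqrt (∑ i, u i ^ 2) * Real.sqrt (∑ i, z i ^ 2) :=
        Real.sum_mul_le_sqrt_mul_sqrt _ _ _
    _ ≤ Real.sqrt (∑ i, x i ^ 2) * (t * Real.sqrt (∑ i, f i ^ 2)) := by
        rw [hu]
        gcongr
    _ = _ := by ring

/-- A set of outcomes has at most its weight under the product of the outcome probabilities. -/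
theorem IsBradleyTerry.measureReal_le {w : Fin n → ℝ} {Ω : Type*}
    [MeasurableSpace Ω] {P : Measure Ω} [IsProbabilityMeasure P] {Y : Pair G × Fin k → Ω → Bool}
    (hY : IsBradleyTerry G w P Y) (B : Finset (Outcomes G k)) :
    P.real {ω | (fun q => Y q ω) ∈ B} ≤ ∑ y ∈ B, prodWeight (outcomeProb G w) y := by
  have hsub : {ω | (fun q => Y q ω) ∈ B} ⊆ ⋃ y ∈ B, ⋂ q ∈ Finset.univ, Y q ⁻¹' {y q} := by
    intro ω hω
    simp only [Set.mem_iUnion]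
    exact ⟨_, hω, by simp⟩
  refine (measureReal_mono hsub (measure_ne_top P _)).trans ((measureReal_biUnion_finset_le B _).trans
    (Finset.sum_le_sum fun y _ => le_of_eq ?_))
  rw [measureReal_def, hY.indep.measure_inter_preimage_eq_mul Finset.univ
    fun q _ => MeasurableSet.singleton _, ENNReal.toReal_prod, prodWeight]
  refine Finset.prod_congr rfl fun q _ => ?_
  rw [← measureReal_def]
  have htrue : P.real (Y q ⁻¹' {true}) = w q.1.1.1 / (w q.1.1.1 + w q.1.1.2) := hY.law q.1 q.2
  cases y q with
  | true => simpa [outcomeProb] using htrue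
  | false =>
    have : Y q ⁻¹' {false} = (Y q ⁻¹' {true})ᶜ := by
      ext ω
      simp
    rw [this, probReal_compl_eq_one_sub (hY.measurable q (MeasurableSet.singleton _)), htrue]
    simp [outcomeProb]

/-- The base is `16 ⌈log n⌉ / (400 log n)`, which is at most `1/9 ≤ e⁻²` since `log n ≥ 0.69`. Its
power is then at most `n⁻²`, which beats the dimension `2n`. -/
theorem tail_le {n : ℕ} (hn : 2 ≤ n) {k D : ℝ} (hk : 0 < k) (hD : 0 < D) :
    2 * n * (4 * ⌈Real.log n⌉₊ * (4 * k * D) / Real.sqrt (400 * k * D * Real.log n) ^ 2) ^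
      ⌈Real.log n⌉₊ ≤ 2 / (n : ℝ) := by
  have hn' : (2 : ℝ) ≤ n := by exact_mod_cast hn
  have hn0 : (0 : ℝ) < n := by linarith
  set l := Real.log n with hl
  have hl2 : 0.69 ≤ l := by
    have h1 := Real.log_le_log two_pos hn'
    have h2 := Real.log_two_gt_d9
    linarith
  have hl0 : 0 < l := by linarith
  have hp : (⌈l⌉₊ : ℝ) ≤ l + 1 := (Nat.ceil_lt_add_one hl0.le).le
  rw [Real.sq_sqrt (by positivity)]
  have he : 4 * ⌈l⌉₊ * (4 * k * D) / (400 * k * D * l) ≤ Real.exp (-2) := by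
    have h1 : (1 : ℝ) / 9 ≤ Real.exp (-2) := by
      rw [Real.exp_neg, one_div]
      refine inv_anti₀ (Real.exp_pos 2) ?_
      have h2 := Real.exp_one_lt_d9
      have h3 : Real.exp 2 = Real.exp 1 * Real.exp 1 := by
        rw [← Real.exp_add]
        norm_num
      rw [h3]
      nlinarith [Real.exp_pos 1]
    refine le_trans ?_ h1
    rw [div_le_iff₀ (by positivity)]
    have h2 : 16 * (⌈l⌉₊ : ℝ) ≤ 400 / 9 * l := by linarith
    have := mul_le_mul_of_nonneg_right h2 (mul_pos hk hD).le
    linarith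
  have hpow : (4 * ⌈l⌉₊ * (4 * k * D) / (400 * k * D * l)) ^ ⌈l⌉₊ ≤ ((n : ℝ) ^ 2)⁻¹ := by
    calc _ ≤ Real.exp (-2) ^ ⌈l⌉₊ := by gcongr
      _ = Real.exp (⌈l⌉₊ * (-2)) := (Real.exp_nat_mul _ _).symm
      _ ≤ Real.exp (-(2 * l)) := by
          refine Real.exp_le_exp.mpr ?_
          have := Nat.le_ceil l
          linarith
      _ = _ := by
          rw [Real.exp_neg, two_mul, Real.exp_add, hl, Real.exp_log hn0, pow_two]
  calc _ ≤ 2 * n * ((n : ℝ) ^ 2)⁻¹ := by gcongr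
    _ = _ := by field_simp

/-- With high probability the noise matrix is small in operator norm. -/
theorem IsBradleyTerry.one_sub_le {w : Fin n → ℝ} (hw : ∀ i, 0 < w i) (hn : 2 ≤ n)
    (hk : 0 < k) (hD : 0 < G.maxDegree) {Ω : Type*} [MeasurableSpace Ω] {P : Measure Ω}
    [IsProbabilityMeasure P] {Y : Pair G × Fin k → Ω → Bool} (hY : IsBradleyTerry G w P Y) :
    1 - 2 / (n : ℝ) ≤ P.real {ω | ∀ v, noiseMatrix G w (fun q => Y q ω) *ᵥ v ⬝ᵥ
      noiseMatrix G w (fun q => Y q ω) *ᵥ v ≤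
        Real.sqrt (400 * k * G.maxDegree * Real.log n) ^ 2 * (v ⬝ᵥ v)} := by
  classical
  set t := Real.sqrt (400 * k * G.maxDegree * Real.log n) with ht
  have hk' : (0 : ℝ) < k := by exact_mod_cast hk
  have hD' : (0 : ℝ) < G.maxDegree := by exact_mod_cast hD
  have hlog : 0 < Real.log n := Real.log_pos (by exact_mod_cast hn)
  set B : Finset (Outcomes G k) := Finset.univ.filter fun y =>
    ∃ v, t ^ 2 * (v ⬝ᵥ v) < noiseMatrix G w y *ᵥ v ⬝ᵥ noiseMatrix G w y *ᵥ v with hB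
  have hsum := sum_prodWeight_filter_le (noiseMatrix G w)
    (fun q : Pair G × Fin k => pairMatrix G q.1) (noise G w)
    (outcomeProb_nonneg hw) (sum_outcomeProb w) (sum_outcomeProb_mul_noise w) (abs_noise_le hw)
    (abs_noise_sub_le w) (fun q => isSymm_pairMatrix q.1) (fun y => rfl)
    (V := 4 * k * G.maxDegree) (by positivity) (sum_pairMatrix_le k G)
    (p := ⌈Real.log n⌉₊) (Nat.ceil_pos.mpr hlog).ne' (t := t) (by positivity) B
    (fun y hy => (Finset.mem_filter.mp hy).2)
  have hcard : (Fintype.card (Fin n ⊕ Fin n) : ℝ) = 2 * n := by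
    rw [Fintype.card_sum, Fintype.card_fin]
    push_cast
    ring
  rw [hcard] at hsum
  have hbad := (hY.measureReal_le B).trans (hsum.trans (tail_le hn hk' hD'))
  have hmeas : MeasurableSet {ω | (fun q => Y q ω) ∈ B} :=
    (measurable_pi_lambda _ hY.measurable) (B : Set (Outcomes G k)).toFinite.measurableSet
  have hcompl := probReal_compl_eq_one_sub (μ := P) hmeas
  refine le_trans (by rw [hcompl]; linarith) (measureReal_mono
    (s₁ := {ω | (fun q => Y q ω) ∈ B}ᶜ) fun ω hω v => ?_)
  by_contra! hlt
  exact hω (Finset.mem_filter.mpr ⟨Finset.mem_univ _, v, hlt⟩)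

end Concentration

/-! ### Choice of constants and conclusion. -/

theorem one_le_dynamicRange {n : ℕ} [NeZero n] {w : Fin n → ℝ} (hw : ∀ i, 0 < w i) :
    1 ≤ dynamicRange w := by
  have h := le_ciSup (f := fun q : Fin n × Fin n => w q.1 / w q.2) (Set.finite_range _).bddAbove
    (0, 0)
  rwa [div_self (hw 0).ne'] at h

/-- The choice of constants: the noise level is small compared with the spectral gap. -/
theorem noise_level_le {b γ D δ k l : ℝ} (hb : 1 ≤ b) (hγ : 0 < γ) (hD : 0 < D) (hδ : 0 < δ)
    (hk0 : 0 < k) (hl : 0 < l)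
    (hk : 4 * 100 ^ 2 * (1 + b ^ 5 * (D / δ) ^ 2 / (D * γ ^ 2) * l) ≤ k) :
    Real.sqrt (400 * k * D * l) / k ≤ γ * δ / (4 * (b * Real.sqrt b)) := by
  have hb0 : 0 < b := by linarith
  have hsb := Real.sqrt_pos.mpr hb0
  rw [div_le_div_iff₀ hk0 (by positivity)]
  refine le_of_pow_le_pow_left₀ two_ne_zero (by positivity) ?_
  have h1 : 40000 * (b ^ 5 * D * l) ≤ k * (γ ^ 2 * δ ^ 2) := by
    have h2 : 40000 * (b ^ 5 * (D / δ) ^ 2 / (D * γ ^ 2) * l) ≤ k := by linarith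
    have e : b ^ 5 * (D / δ) ^ 2 / (D * γ ^ 2) * l = b ^ 5 * D * l / (γ ^ 2 * δ ^ 2) := by
      field_simp
    rwa [e, mul_div_assoc', div_le_iff₀ (by positivity)] at h2
  rw [mul_pow, mul_pow, mul_pow b, Real.sq_sqrt hb0.le, Real.sq_sqrt (by positivity)]
  have h3 : b ^ 3 ≤ b ^ 5 := pow_le_pow_right₀ hb (by norm_num)
  -- The squared inequality needs only `b ^ 3` and the constant `6400 = 400 * 16`; the hypothesis
  -- supplies `b ^ 5` and `40000`.
  have h4 : b ^ 3 * (D * l) ≤ b ^ 5 * (D * l) := by gcongr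
  have h5 : 6400 * (b ^ 3 * (D * l)) ≤ k * (γ ^ 2 * δ ^ 2) := by
    have : 0 < b ^ 5 * (D * l) := by positivity
    linarith
  have := mul_le_mul_of_nonneg_left h5 hk0.le
  linarith

end RankCentrality

end


theorem mainTheorem6 :
    ∃ C c α : ℝ, 0 < C ∧ 0 < c ∧ 0 < α ∧
      ∀ (n k : ℕ) (_ : 2 ≤ n) (G : SimpleGraph (Fin n)) [DecidableRel G.Adj] (_ : G.Connected)
        (w : Fin n → ℝ) (_ : ∀ i, 0 < w i)
        (_ : ∀ i, w i ∈ Set.Icc (1 / RankCentrality.dynamicRange w) 1)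
        (_ : 4 * C ^ 2 *
              (1 + RankCentrality.dynamicRange w ^ 5 * RankCentrality.degreeRatio G ^ 2 /
                  ((G.maxDegree : ℝ) * RankCentrality.spectralGap G ^ 2) * Real.log n) ≤ (k : ℝ))
        (Ω : Type*) [MeasurableSpace Ω] (P : Measure Ω) [IsProbabilityMeasure P]
        (Y : RankCentrality.Pair G × Fin k → Ω → Bool)
        (_ : RankCentrality.IsBradleyTerry G w P Y),
        1 - c / (n : ℝ) ^ α ≤
          P.real {ω | ∃ π : Fin n → ℝ, RankCentrality.IsEstimate G (fun q => Y q ω) π ∧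
            ‖WithLp.toLp 2 (RankCentrality.weights w π - w)‖ <
              C * (RankCentrality.dynamicRange w ^ 3 * RankCentrality.degreeRatio G /
                  RankCentrality.spectralGap G) *
                Real.sqrt ((n : ℝ) * Real.log n / ((k : ℝ) * (G.maxDegree : ℝ)))} := by
  -- The failure probability is `2 / n`. The error constant obtained is `4 * √400 = 80`; any larger
  -- one makes the final inequality strict.
  refine ⟨100, 2, 1, by norm_num, by norm_num, by norm_num, ?_⟩
  intro n k hn G _ hG w hw hwb hk Ω _ P _ Y hY
  have : NeZero n := ⟨by omega⟩
  have : Nontrivial (Fin n) := Fin.nontrivial_iff_two_le.mpr hn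
  have hd : ∀ i, 0 < G.degree i := fun i => hG.preconnected.degree_pos_of_nontrivial i
  have hγ := RankCentrality.spectralGap_pos hG hd
  have hb := RankCentrality.one_le_dynamicRange hw
  have hD : 0 < G.maxDegree := (hd 0).trans_le (G.degree_le_maxDegree 0)
  have hδ : 0 < G.minDegree := by
    obtain ⟨v, hv⟩ := G.exists_minimal_degree_vertex
    exact hv ▸ hd v
  have hl : 0 < Real.log n := Real.log_pos (by exact_mod_cast hn)
  unfold RankCentrality.degreeRatio at hk ⊢
  set b := RankCentrality.dynamicRange w
  set γ := RankCentrality.spectralGap G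
  have hDR : (0 : ℝ) < G.maxDegree := by exact_mod_cast hD
  have hδR : (0 : ℝ) < G.minDegree := by exact_mod_cast hδ
  have hb0 : 0 < b := by linarith
  have hkR : (0 : ℝ) < k := lt_of_lt_of_le (by positivity) hk
  have hk0 : 0 < k := by exact_mod_cast hkR
  have hn0 : (0 : ℝ) < n := by exact_mod_cast (by omega : 0 < n)
  rw [Real.rpow_one]
  refine (hY.one_sub_le hw hn hk0 hD).trans (measureReal_mono fun ω hω => ?_)
  obtain ⟨π, hπ, hle⟩ := RankCentrality.exists_isEstimate hw hb0 hwb hd hγ (fun q => Y q ω)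
    (by positivity) (RankCentrality.deviationForm_le hw hk0 _ (Real.sqrt_nonneg _) hω)
    (RankCentrality.noise_level_le hb hγ hDR hδR hkR hl hk)
  refine ⟨π, hπ, ?_⟩
  have hnorm : ‖WithLp.toLp 2 (RankCentrality.weights w π - w)‖ =
      Real.sqrt (∑ i, (RankCentrality.weights w π i - w i) ^ 2) := by
    rw [EuclideanSpace.norm_eq]
    simp
  rw [hnorm]
  set R := Real.sqrt (n * Real.log n / (k * G.maxDegree)) with hR
  have hR0 : 0 < R := Real.sqrt_pos.mpr (by positivity)
  have hKR : Real.sqrt (400 * k * G.maxDegree * Real.log n) / k * Real.sqrt n =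
      20 * G.maxDegree * R := by
    have h1 : 20 * (G.maxDegree : ℝ) * R =
        Real.sqrt ((20 * G.maxDegree) ^ 2 * (n * Real.log n / (k * G.maxDegree))) := by
      rw [Real.sqrt_mul (by positivity), Real.sqrt_sq (by positivity)]
    rw [h1, div_mul_eq_mul_div, ← Real.sqrt_mul (by positivity), div_eq_iff hkR.ne']
    have h2 : ∀ A : ℝ, Real.sqrt A * k = Real.sqrt (A * k ^ 2) := fun A => by
      rw [Real.sqrt_mul' _ (sq_nonneg _), Real.sqrt_sq hkR.le]
    rw [h2]
    congr 1
    field_simp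
    ring
  -- The argument gives the error with `b ^ (3/2)`, which is weakened here to `b ^ 3`.
  have hsb : Real.sqrt b ≤ b := by
    rw [Real.sqrt_le_left hb0.le]
    nlinarith
  have hb3 : b * Real.sqrt b ≤ b ^ 3 := by
    calc b * Real.sqrt b ≤ b * b := by gcongr
      _ = b ^ 2 := by ring
      _ ≤ b ^ 3 := pow_le_pow_right₀ hb (by norm_num)
  rw [mul_assoc, hKR] at hle
  have hg : 0 < γ * G.minDegree := mul_pos hγ hδR
  refine lt_of_mul_lt_mul_right (lt_of_le_of_lt hle ?_) hg.le
  have e : 100 * (b ^ 3 * (G.maxDegree / G.minDegree) / γ) * R * (γ * G.minDegree) =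
      100 * b ^ 3 * (G.maxDegree * R) := by
    field_simp
  rw [e]
  have h2 : 0 < (G.maxDegree : ℝ) * R := mul_pos hDR hR0
  calc 4 * (b * Real.sqrt b) * (20 * G.maxDegree * R)
      = 80 * (b * Real.sqrt b) * (G.maxDegree * R) := by ring
    _ ≤ 80 * b ^ 3 * (G.maxDegree * R) := by gcongr
    _ < 100 * b ^ 3 * (G.maxDegree * R) := by
        gcongr
        norm_num
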